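/- **(Double Excision)** Let $R$ be a commutative ring with $1$, $I\subseteq R$ an ideal, and $n\ge 3$. *Notation.* $\mathrm{Um}_n(R)$ is the set of rows $v\in R^n$ with $v\,w^t=1$ for some $w\in R^n$, and $\mathrm{Um}_n(R,I)$ is the set of those $v\in\mathrm{Um}_n(R)$ with $v\equiv e_1=(1,0,\dots,0)\pmod I$. $\mathrm E_n(R)\subseteq \mathrm{GL}_n(R)$ is the subgroup generated by the elementary matrices $E_{ij}(c)$, $i\ne j$, $c\in R$, and $\mathrm E_n(R,I)$ is the smallest normal subgroup of $\mathrm E_n(R)$ containing all $E_{21}(x)$, $x\in I$. These groups act by right multiplication; put $\mathrm{MSE}_n(R)=\mathrm{Um}_n(R)/\mathrm E_n(R)$ and $\mathrm{MSE}_n(R,I)=\mathrm{Um}_n(R,I)/\mathrm E_n(R,I)$. For $A=\mathbb Z$ or $A=R$ the excision ring $A\oplus I$ has coordinatewise addition and the product $(r,i)(s,j)=(rs,\,rj+si+ij)$, and $0\oplus I$ is its ideal of elements with first coordinate $0$. Let $f:\mathbb Z\oplus I\to R$, $f(m,i)=m+i$, let $\pi_2:R\oplus I\to R$, $\pi_2(a,i)=a+i$,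 and let $\varphi:\mathbb Z\oplus(0\oplus I)\to\mathbb Z\oplus I$, $\varphi(m,(0,i))=(m,i)$, where in $\mathbb Z\oplus(0\oplus I)$ the set $0\oplus I$ is regarded as an ideal of $R\oplus I$. The map $f$ induces $F:\mathrm{MSE}_n(\mathbb Z\oplus I,0\oplus I)\to\mathrm{MSE}_n(R,I)$, and $[v]\mapsto[v]$ defines $G:\mathrm{MSE}_n(\mathbb Z\oplus I,0\oplus I)\to\mathrm{MSE}_n(\mathbb Z\oplus I)$; these constructions apply in the same way to the ideal $0\oplus I$ of $R\oplus I$. *(a)* The natural maps $$\mathrm{MSE}_n(R\oplus I,0\oplus I)\xleftarrow{F}\mathrm{MSE}_n(\mathbb Z\oplus(0\oplus I),\,0\oplus I)\xrightarrow{G}\mathrm{MSE}_n(\mathbb Z\oplus(0\oplus I))\xrightarrow{\varphi}\mathrm{MSE}_n(\mathbb Z\oplus I)\xleftarrow{G}\mathrm{MSE}_n(\mathbb Z\oplus I,0\oplus I)\xrightarrow{F}\mathrm{MSE}_n(R,I)$$ are all bijections, and so is the map $\pi_2:\mathrm{MSE}_n(R\oplus I,0\oplus I)\to\mathrm{MSE}_n(R,I)$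 induced by $\pi_2$. *(b)* An operation $*$ on $\mathrm{MSE}_n(A)$, $A$ a commutative ring, *follows the Vaserstein–van der Kallen rule* if $$[(b,a_2,\dots,a_n)]*[(a,a_2,\dots,a_n)]=[(a(b+p)-1,\;a_2(b+p),\;a_3,\dots,a_n)]$$ for all unimodular rows $(a,a_2,\dots,a_n)$, $(b,a_2,\dots,a_n)$ over $A$ and all $p\in A$ with $ap\equiv1 \pmod{(a_2,\dots,a_n)}$. An operation on $\mathrm{MSE}_n(R,I)$ follows the rule if the operation which it induces on $\mathrm{MSE}_n(\mathbb Z\oplus I)$ through the bijections $F,G$ follows it. We say that the rule *gives the product* of two classes in $\mathrm{MSE}_n(R,I)$ if the corresponding classes in $\mathrm{MSE}_n(\mathbb Z\oplus I)$ have representatives $(b,a_2,\dots,a_n)$ and $(a,a_2,\dots,a_n)$ with the same last $n-1$ coordinates. A group structure on $\mathrm{MSE}_n(R,I)$ following the rule is *nice* if $[(b,a_2,\dots,a_n)]*[(a,a_2,\dots,a_n)]=[(ab,a_2,\dots,a_n)]$ for all $(a,a_2,\dots,a_n),(b,a_2,\dots,a_n)\in\mathrm{Um}_n(R,I)$. Assume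 that $\mathrm{MSE}_n(R,I)$ and $\mathrm{MSE}_n(R\oplus I,0\oplus I)$ carry group structures that follow the Vaserstein–van der Kallen rule. Then $\pi_2(xy)=\pi_2(x)\pi_2(y)$ for all $x,y\in\mathrm{MSE}_n(R\oplus I,0\oplus I)$ whose product is given by the rule. In particular, if the rule gives the product of any two classes in $\mathrm{MSE}_n(R\oplus I,0\oplus I)$, then $\pi_2:\mathrm{MSE}_n(R\oplus I,0\oplus I)\to\mathrm{MSE}_n(R,I)$ is a group homomorphism. Moreover (without this last assumption), the group structure on $\mathrm{MSE}_n(R\oplus I,0\oplus I)$ is nice if and only if the one on $\mathrm{MSE}_n(R,I)$ is nice. -/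

import Mathlib

noncomputable section

namespace Excision

open Matrix

section OrbitSpaces

variable (n : ℕ) [NeZero n] (R : Type*) [CommRing R] (I : Ideal R)

/-- A row `v` is unimodular if `v · wᵗ = 1` for some row `w`. -/
def IsUnimodular {n : ℕ} {R : Type*} [CommRing R] (v : Fin n → R) : Prop :=
  ∃ w : Fin n → R, v ⬝ᵥ w = 1

/-- `Um_n(R)`. -/
def Um : Set (Fin n → R) := {v | IsUnimodular v}

/-- `Um_n(R, I)`: unimodular rows congruent to `e₁ = (1, 0, …, 0)` modulo `I`. -/
def UmRel : Set (Fin n → R) :=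
  {v | IsUnimodular v ∧ v 0 - 1 ∈ I ∧ ∀ i, i ≠ 0 → v i ∈ I}

/-- `E_n(R)`, the subgroup of `GL_n(R)` generated by all `E_{ij}(c)`, `i ≠ j`. -/
def elementary : Subgroup (GL (Fin n) R) :=
  Subgroup.closure {g | ∃ i j, i ≠ j ∧ ∃ c : R, (g : Matrix (Fin n) (Fin n) R) = transvection i j c}

/-- `E_n(R, I)`, the smallest normal subgroup of `E_n(R)` containing all `E_{21}(x)`, `x ∈ I`,
viewed as a subgroup of `GL_n(R)`.  (Indices start at `0`, so `E_{21}` is `transvection 1 0`.) -/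
def elementaryRel : Subgroup (GL (Fin n) R) :=
  (Subgroup.normalClosure {g : elementary n R |
    ∃ x ∈ I, ((g : GL (Fin n) R) : Matrix (Fin n) (Fin n) R) = transvection 1 0 x}).map
      (elementary n R).subtype

/-- The relation "same orbit" on a set `S` of rows, for a subgroup `H` of `GL_n(R)` acting by right
multiplication. -/
def orbitSetoid {n : ℕ} {R : Type*} [CommRing R] (S : Set (Fin n → R))
    (H : Subgroup (GL (Fin n) R)) : Setoid S where
  r v w := ∃ g ∈ H, (v : Fin n → R) ᵥ* (g : Matrix (Fin n) (Fin n) R) = w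
  iseqv :=
    { refl := fun v => ⟨1, H.one_mem, by simp⟩
      symm := by
        rintro v w ⟨g, hg, h⟩
        refine ⟨g⁻¹, H.inv_mem hg, ?_⟩
        rw [← h, Matrix.vecMul_vecMul, ← Units.val_mul, mul_inv_cancel]
        simp
      trans := by
        rintro u v w ⟨g, hg, h⟩ ⟨k, hk, h'⟩
        refine ⟨g * k, H.mul_mem hg hk, ?_⟩
        rw [Units.val_mul, ← Matrix.vecMul_vecMul, h, h'] }

/-- `MSE_n(R) = Um_n(R) / E_n(R)`. -/
def MSE : Type _ := Quotient (orbitSetoid (Um n R) (elementary n R))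

/-- `MSE_n(R, I) = Um_n(R, I) / E_n(R, I)`. -/
def MSERel : Type _ := Quotient (orbitSetoid (UmRel n R I) (elementaryRel n R I))

variable {n R I}

/-- The class `[v]` in `MSE_n(R)`. -/
def MSE.mk (v : Um n R) : MSE n R := Quotient.mk _ v

/-- The class `[v]` in `MSE_n(R, I)`. -/
def MSERel.mk (v : UmRel n R I) : MSERel n R I := Quotient.mk _ v

end OrbitSpaces

section NaturalMaps

variable {n : ℕ} {R S : Type*} [CommRing R] [CommRing S]

theorem IsUnimodular.map (f : R →+* S) {v : Fin n → R} (h : IsUnimodular v) :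
    IsUnimodular (f ∘ v) := by
  obtain ⟨w, hw⟩ := h
  refine ⟨f ∘ w, ?_⟩
  rw [← RingHom.map_dotProduct, hw, map_one]

theorem transvection_map (f : R →+* S) (i j : Fin n) (c : R) :
    (transvection i j c).map f = transvection i j (f c) := by
  ext a b
  simp only [transvection, Matrix.map_apply, Matrix.add_apply, map_add, Matrix.one_apply,
    Matrix.single_apply]
  congr 1 <;> split_ifs <;> simp

theorem elementary_map (f : R →+* S) {g : GL (Fin n) R} (hg : g ∈ elementary n R) :
    GeneralLinearGroup.map f g ∈ elementary n S := by
  have : elementary n R ≤ (elementary n S).comap (GeneralLinearGroup.map f) := by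
    refine (Subgroup.closure_le _).2 ?_
    rintro g ⟨i, j, hij, c, hc⟩
    refine Subgroup.subset_closure ⟨i, j, hij, f c, ?_⟩
    rw [← transvection_map, ← hc]
    rfl
  exact this hg

theorem elementaryRel_le [NeZero n] (I : Ideal R) : elementaryRel n R I ≤ elementary n R := by
  rintro _ ⟨g, -, rfl⟩
  exact g.2

theorem elementaryRel_map [NeZero n] (f : R →+* S) {I : Ideal R} {J : Ideal S}
    (h : I ≤ J.comap f) {g : GL (Fin n) R} (hg : g ∈ elementaryRel n R I) :
    GeneralLinearGroup.map f g ∈ elementaryRel n S J := by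
  let F : elementary n R →* elementary n S :=
    ((GeneralLinearGroup.map f).comp (elementary n R).subtype).codRestrict (elementary n S)
      (fun g => elementary_map f g.2)
  obtain ⟨g, hg, rfl⟩ := hg
  refine ⟨F g, ?_, rfl⟩
  have key : Subgroup.normalClosure {g : elementary n R | ∃ x ∈ I,
      ((g : GL (Fin n) R) : Matrix (Fin n) (Fin n) R) = transvection 1 0 x} ≤
      (Subgroup.normalClosure {g : elementary n S | ∃ x ∈ J,
      ((g : GL (Fin n) S) : Matrix (Fin n) (Fin n) S) = transvection 1 0 x}).comap F := by
    refine Subgroup.normalClosure_le_normal ?_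
    rintro g ⟨x, hx, hg⟩
    refine Subgroup.subset_normalClosure ⟨f x, h hx, ?_⟩
    rw [← transvection_map, ← hg]
    rfl
  exact key hg

theorem vecMul_map (f : R →+* S) (v : Fin n → R) (g : GL (Fin n) R) :
    (f ∘ v) ᵥ* (GeneralLinearGroup.map f g : Matrix (Fin n) (Fin n) S) =
      f ∘ (v ᵥ* (g : Matrix (Fin n) (Fin n) R)) := by
  funext i
  simp [RingHom.map_vecMul]

/-- The map `[(aᵢ)] ↦ [(f aᵢ)]` on absolute orbit spaces. -/
def MSE.map (n : ℕ) (f : R →+* S) : MSE n R → MSE n S :=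
  Quotient.map (fun v => ⟨f ∘ v.1, IsUnimodular.map f v.2⟩) (by
    rintro ⟨v, hv⟩ ⟨w, hw⟩ ⟨g, hg, h⟩
    refine ⟨GeneralLinearGroup.map f g, elementary_map f hg, ?_⟩
    change v ᵥ* (g : Matrix (Fin n) (Fin n) R) = w at h
    change (f ∘ v) ᵥ* _ = f ∘ w
    rw [vecMul_map, h])

/-- The map `[(aᵢ)] ↦ [(f aᵢ)]` on relative orbit spaces, when `f` maps `I` into `J`. -/
def MSERel.map (n : ℕ) [NeZero n] (f : R →+* S) {I : Ideal R} {J : Ideal S}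
    (hf : I ≤ J.comap f) : MSERel n R I → MSERel n S J :=
  Quotient.map (fun v => ⟨f ∘ v.1, IsUnimodular.map f v.2.1,
      by simpa using hf v.2.2.1, fun i hi => hf (v.2.2.2 i hi)⟩) (by
    rintro ⟨v, hv⟩ ⟨w, hw⟩ ⟨g, hg, h⟩
    refine ⟨GeneralLinearGroup.map f g, elementaryRel_map f hf hg, ?_⟩
    change v ᵥ* (g : Matrix (Fin n) (Fin n) R) = w at h
    change (f ∘ v) ᵥ* _ = f ∘ w
    rw [vecMul_map, h])

/-- The map `MSE_n(R, I) → MSE_n(R)`, `[(aᵢ)] ↦ [(aᵢ)]`. -/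
def MSERel.toMSE (n : ℕ) [NeZero n] (I : Ideal R) : MSERel n R I → MSE n R :=
  Quotient.map (fun v => ⟨v.1, v.2.1⟩) (by
    rintro ⟨v, hv⟩ ⟨w, hw⟩ ⟨g, hg, h⟩
    exact ⟨g, elementaryRel_le I hg, h⟩)

end NaturalMaps

section ExcisionRings

variable {R : Type*} [CommRing R] (I : Ideal R)

/-- The excision ring `ℤ ⊕ I`, with `(m, i)(k, j) = (mk, mj + ki + ij)`. -/
abbrev ZPlus : Type _ := Unitization ℤ I

/-- The excision ring `R ⊕ I`, with `(r, i)(s, j) = (rs, rj + si + ij)`. -/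
abbrev RPlus : Type _ := Unitization R I

/-- The ideal `0 ⊕ I` of `ℤ ⊕ I`. -/
def zIdeal : Ideal (ZPlus I) := RingHom.ker (Unitization.fstHom ℤ I)

/-- The ideal `0 ⊕ I` of `R ⊕ I`. -/
def rIdeal : Ideal (RPlus I) := RingHom.ker (Unitization.fstHom R I)

/-- `f : ℤ ⊕ I → R`, `f(m, i) = m + i`. -/
def zHom : ZPlus I →+* R where
  toFun x := (x.fst : R) + (x.snd : R)
  map_one' := by simp
  map_zero' := by simp
  map_add' x y := by simp; ring
  map_mul' x y := by simp; ring

/-- `π₂ : R ⊕ I → R`, `π₂(a, i) = a + i`. -/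
def rHom : RPlus I →+* R where
  toFun x := x.fst + (x.snd : R)
  map_one' := by simp
  map_zero' := by simp
  map_add' x y := by simp; ring
  map_mul' x y := by simp; ring

/-- `φ : ℤ ⊕ (0 ⊕ I) → ℤ ⊕ I`, `φ(m, (0, i)) = (m, i)`, where `0 ⊕ I` is an ideal of `R ⊕ I`. -/
def phi : ZPlus (rIdeal I) →+* ZPlus I where
  toFun x := Unitization.inl x.fst + Unitization.inr ((x.snd : RPlus I).snd)
  map_one' := by ext <;> simp
  map_zero' := by ext <;> simp
  map_add' x y := by ext <;> simp
  map_mul' x y := by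
    have hx : (x.snd : RPlus I).fst = 0 := x.snd.2
    have hy : (y.snd : RPlus I).fst = 0 := y.snd.2
    have hk (k : ℤ) : (k : RPlus I) = Unitization.inl (k : R) :=
      (map_intCast (Unitization.inlRingHom R I) k).symm
    ext <;> simp [hx, hy, hk]

theorem zIdeal_le : zIdeal I ≤ I.comap (zHom I) := by
  intro x hx
  have hx : x.fst = 0 := hx
  simp [zHom, hx]

theorem rIdeal_le : rIdeal I ≤ I.comap (rHom I) := by
  intro x hx
  have hx : x.fst = 0 := hx
  simp [rHom, hx]

variable (n : ℕ) [NeZero n]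

/-- `F : MSE_n(ℤ ⊕ I, 0 ⊕ I) → MSE_n(R, I)`, induced by `f`. -/
def mapF : MSERel n (ZPlus I) (zIdeal I) → MSERel n R I :=
  MSERel.map n (zHom I) (zIdeal_le I)

/-- `G : MSE_n(ℤ ⊕ I, 0 ⊕ I) → MSE_n(ℤ ⊕ I)`. -/
def mapG : MSERel n (ZPlus I) (zIdeal I) → MSE n (ZPlus I) :=
  MSERel.toMSE n (zIdeal I)

/-- `MSE_n(ℤ ⊕ (0 ⊕ I)) → MSE_n(ℤ ⊕ I)`, induced by `φ`. -/
def mapPhi : MSE n (ZPlus (rIdeal I)) → MSE n (ZPlus I) :=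
  MSE.map n (phi I)

/-- `π₂ : MSE_n(R ⊕ I, 0 ⊕ I) → MSE_n(R, I)`. -/
def mapPi₂ : MSERel n (RPlus I) (rIdeal I) → MSERel n R I :=
  MSERel.map n (rHom I) (rIdeal_le I)

end ExcisionRings

section Vv

variable {n : ℕ} [NeZero n] {R : Type*} [CommRing R]

/-- The row `(a(b + p) - 1, a₂(b + p), a₃, …, aₙ)` for `v = (a, a₂, …, aₙ)`. -/
def vvRow (v : Fin n → R) (b p : R) : Fin n → R := fun i =>
  if i = 0 then v 0 * (b + p) - 1 else if i = 1 then v 1 * (b + p) else v i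

/-- An operation on `MSE_n(R)` follows the Vaserstein–van der Kallen rule: for
`v = (a, a₂, …, aₙ)` and `w = (b, a₂, …, aₙ)` in `Um_n(R)` and `p` with
`a p ≡ 1 mod (a₂, …, aₙ)`, one has `[w] * [v] = [(a(b + p) - 1, a₂(b + p), a₃, …, aₙ)]`. -/
def FollowsVv (op : MSE n R → MSE n R → MSE n R) : Prop :=
  ∀ v w : Um n R, (∀ i, i ≠ 0 → w.1 i = v.1 i) →
    ∀ p : R, v.1 0 * p - 1 ∈ Ideal.span (v.1 '' {i | i ≠ 0}) →
      ∃ h : vvRow v.1 (w.1 0) p ∈ Um n R, op (MSE.mk w) (MSE.mk v) = MSE.mk ⟨_, h⟩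

/-- `op'` is the operation on `MSE_n(ℤ ⊕ I)` induced by the operation `op` on `MSE_n(R, I)`
through `F` and `G`. -/
def IsInduced (I : Ideal R) (op : MSERel n R I → MSERel n R I → MSERel n R I)
    (op' : MSE n (ZPlus I) → MSE n (ZPlus I) → MSE n (ZPlus I)) : Prop :=
  ∀ x y z : MSERel n (ZPlus I) (zIdeal I),
    mapF I n z = op (mapF I n x) (mapF I n y) →
      op' (mapG I n x) (mapG I n y) = mapG I n z

/-- An operation on `MSE_n(R, I)` follows the Vaserstein–van der Kallen rule if the induced
operation on `MSE_n(ℤ ⊕ I)` does. -/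
def FollowsVvRel (I : Ideal R) (op : MSERel n R I → MSERel n R I → MSERel n R I) : Prop :=
  ∃ op', IsInduced I op op' ∧ FollowsVv op'

/-- Two classes in `MSE_n(R)` can be written as `[(b, a₂, …, aₙ)]` and `[(a, a₂, …, aₙ)]`, so
that the Vaserstein–van der Kallen rule gives their product. -/
def CommonTail (x y : MSE n R) : Prop :=
  ∃ v w : Um n R, MSE.mk w = x ∧ MSE.mk v = y ∧ ∀ i, i ≠ 0 → w.1 i = v.1 i

/-- Two classes in `MSE_n(R, I)` correspond, under `F` and `G`, to classes in `MSE_n(ℤ ⊕ I)`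
whose product is given by the Vaserstein–van der Kallen rule. -/
def CommonTailRel (I : Ideal R) (x y : MSERel n R I) : Prop :=
  ∃ x' y' : MSERel n (ZPlus I) (zIdeal I), mapF I n x' = x ∧ mapF I n y' = y ∧
    CommonTail (mapG I n x') (mapG I n y')

/-- An operation on `MSE_n(R, I)` is nice:
`[(b, a₂, …, aₙ)] * [(a, a₂, …, aₙ)] = [(ab, a₂, …, aₙ)]` for rows in `Um_n(R, I)`. -/
def IsNiceRel (I : Ideal R) (op : MSERel n R I → MSERel n R I → MSERel n R I) : Prop :=
  ∀ v w : UmRel n R I, (∀ i, i ≠ 0 → w.1 i = v.1 i) →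
    ∃ h : Function.update v.1 0 (v.1 0 * w.1 0) ∈ UmRel n R I,
      op (MSERel.mk w) (MSERel.mk v) = MSERel.mk ⟨_, h⟩

end Vv

end Excision

end

/-! Everything rests on excision for a ring `A` with an augmentation onto `ℤ` and augmentation ideal
`J`, and a homomorphism `φ : A → R` mapping `J` bijectively onto `I`.

For `G` (`toMSE_bijective`): `E_n(ℤ)` is transitive on unimodular rows, and its matrices lift along
`ℤ → A`, so every row over `A` can be moved into `Um_n(A, J)`. If `g` carries one row `v` of
`Um_n(A, J)` to another, the reduction of `g` to `ℤ` fixes `e₁`. The stabilizer of `e₁` in `E_n(ℤ)`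
is generated by transvections `E_{ij}(c)` with `i ≠ 1`, and these lift to elements of `E_n(A)`
fixing `v`. Correcting `g` by such a lift leaves an elementary matrix reducing to `1`, which lies in
`E_n(A, J)` because the augmentation splits.

For `F` (`IsExcision.map_bijective`): a Suslin-type dyad computation factors `E_n(R, I)` into
`E_{ij}(a)`, `i ≠ 1`, and `E_{1j}(y)`, `y ∈ I`. Each acts on lifted rows within an `E_n(A)`-orbit
(`IsExcision.transvection_mem_orbitMonoid`), even though `a` itself need not lift to `A`. The result
for `G` then turns `E_n(A)`-orbits into `E_n(A, J)`-orbits.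

Since `φ` of the theorem is a ring isomorphism and `π₂ ∘ f = f ∘ φ`, the map `π₂` is identified,
through `F` and `G`, with an isomorphism of absolute orbit spaces. The Vaserstein–van der Kallen
formula is natural in ring homomorphisms, which gives (b). -/

noncomputable section

namespace Excision

open Matrix

/-! ### Rank-one perturbations of the identity as products of transvections. -/

section Dyads

variable {n : ℕ} {R : Type*} [CommRing R]

/-- The transvection `E_{ij}(c)`, `i ≠ j`, as an element of `GL_n(R)`. -/
def elemUnit {i j : Fin n} (h : i ≠ j) (c : R) : GL (Fin n) R where
  val := transvection i j c
  inv := transvection i j (-c)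
  val_inv := by rw [transvection_mul_transvection_same _ _ h]; simp
  inv_val := by rw [transvection_mul_transvection_same _ _ h]; simp

@[simp]
theorem coe_elemUnit {i j : Fin n} (h : i ≠ j) (c : R) :
    (elemUnit h c : Matrix (Fin n) (Fin n) R) = transvection i j c := rfl

theorem elemUnit_mem {i j : Fin n} (h : i ≠ j) (c : R) : elemUnit h c ∈ elementary n R :=
  Subgroup.subset_closure ⟨i, j, h, c, rfl⟩

/-- The matrices underlying the elements of a subgroup of `GL_n(R)`. -/
def matrices (T : Subgroup (GL (Fin n) R)) : Submonoid (Matrix (Fin n) (Fin n) R) :=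
  T.toSubmonoid.map (Units.coeHom _)

theorem transvection_mem_matrices {i j : Fin n} (h : i ≠ j) (c : R) :
    transvection i j c ∈ matrices (elementary n R) :=
  ⟨_, elemUnit_mem h c, rfl⟩

theorem transvection_eq_dyad (i j : Fin n) (c : R) :
    transvection i j c = 1 + vecMulVec (Pi.single i 1) (Pi.single j c) := by
  ext a b
  simp only [transvection, Matrix.add_apply, vecMulVec_apply, Matrix.single_apply, Pi.single_apply]
  congr 1
  split_ifs <;> simp_all

theorem vecMul_dyad (v s z : Fin n → R) :
    v ᵥ* (1 + vecMulVec s z) = v + (v ⬝ᵥ s) • z := by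
  rw [Matrix.vecMul_add, Matrix.vecMul_one, vecMul_vecMulVec]

theorem vecMul_transvection (v : Fin n → R) (i j : Fin n) (c : R) :
    v ᵥ* transvection i j c = Function.update v j (v j + v i * c) := by
  rw [transvection_eq_dyad, vecMul_dyad]
  ext a
  by_cases h : a = j
  · subst h; simp
  · simp [h]

/-- The cross term carries the scalar `z ⬝ᵥ s`, which vanishes. Dyads with a common column thus
multiply by adding rows, so membership in a monoid can be checked summand by summand. -/
theorem dyad_mul_dyad_same_left (s z z' : Fin n → R) (h : z ⬝ᵥ s = 0) :
    (1 + vecMulVec s z) * (1 + vecMulVec s z') = 1 + vecMulVec s (z + z') := by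
  rw [add_mul, mul_add, mul_add, vecMulVec_mul_vecMulVec, h, vecMulVec_add]
  simp
  abel

theorem dyad_mul_dyad_same_right (s s' z : Fin n → R) (h : z ⬝ᵥ s' = 0) :
    (1 + vecMulVec s z) * (1 + vecMulVec s' z) = 1 + vecMulVec (s + s') z := by
  rw [add_mul, mul_add, mul_add, vecMulVec_mul_vecMulVec, h, add_vecMulVec]
  simp
  abel

theorem dyad_sum_right_mem (M : Submonoid (Matrix (Fin n) (Fin n) R)) {ι : Type*} (t : Finset ι)
    (s : Fin n → R) (z : ι → Fin n → R) (h0 : ∀ a ∈ t, z a ⬝ᵥ s = 0)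
    (h : ∀ a ∈ t, 1 + vecMulVec s (z a) ∈ M) : 1 + vecMulVec s (∑ a ∈ t, z a) ∈ M := by
  classical
  induction t using Finset.induction_on with
  | empty => simp [M.one_mem]
  | insert a t ha ih =>
    rw [Finset.sum_insert ha, ← dyad_mul_dyad_same_left _ _ _ (h0 a (by simp))]
    exact M.mul_mem (h a (by simp)) (ih (fun b hb => h0 b (by simp [hb]))
      (fun b hb => h b (by simp [hb])))

theorem dyad_sum_left_mem (M : Submonoid (Matrix (Fin n) (Fin n) R)) {ι : Type*} (t : Finset ι)
    (s : ι → Fin n → R) (z : Fin n → R) (h0 : ∀ a ∈ t, z ⬝ᵥ s a = 0)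
    (h : ∀ a ∈ t, 1 + vecMulVec (s a) z ∈ M) : 1 + vecMulVec (∑ a ∈ t, s a) z ∈ M := by
  classical
  induction t using Finset.induction_on with
  | empty => simp [M.one_mem]
  | insert a t ha ih =>
    have h1 : z ⬝ᵥ ∑ b ∈ t, s b = 0 := by
      rw [dotProduct_sum]
      exact Finset.sum_eq_zero fun b hb => h0 b (by simp [hb])
    rw [Finset.sum_insert ha, ← dyad_mul_dyad_same_right _ _ _ h1]
    exact M.mul_mem (h a (by simp)) (ih (fun b hb => h0 b (by simp [hb]))
      (fun b hb => h b (by simp [hb])))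

/-- A dyad `1 + sᵗ z` with `s` and `z` of disjoint supports is a product of transvections. -/
theorem dyad_mem_of_disjoint (M : Submonoid (Matrix (Fin n) (Fin n) R)) (s z : Fin n → R)
    (h0 : ∀ i, s i = 0 ∨ z i = 0)
    (h : ∀ i j, i ≠ j → s i ≠ 0 → z j ≠ 0 → transvection i j (s i * z j) ∈ M) :
    1 + vecMulVec s z ∈ M := by
  have hs : s = ∑ i, Pi.single i (s i) := (Finset.univ_sum_single s).symm
  have hz : z = ∑ i, Pi.single i (z i) := (Finset.univ_sum_single z).symm
  have hzero : ∀ i, z i * s i = 0 := fun i => by rcases h0 i with h | h <;> simp [h]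
  rw [hs]
  refine dyad_sum_left_mem M _ _ _ (fun i _ => by simp [hzero]) fun i _ => ?_
  rw [hz]
  refine dyad_sum_right_mem M _ _ _ (fun j _ => ?_) fun j _ => ?_
  · by_cases hij : j = i
    · subst hij; simp [hzero]
    · simp [hij]
  · have key : vecMulVec (Pi.single i (s i)) (Pi.single j (z j)) =
        vecMulVec (Pi.single i (1 : R)) (Pi.single j (s i * z j)) := by
      ext a b
      simp only [vecMulVec_apply, Pi.single_apply]
      split_ifs <;> simp
    rw [key]
    by_cases hsi : s i = 0
    · simp [hsi, M.one_mem]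
    by_cases hzj : z j = 0
    · simp [hzj, M.one_mem]
    have hij : i ≠ j := by rintro rfl; exact (h0 i).elim hsi hzj
    rw [← transvection_eq_dyad]
    exact h i j hij hsi hzj

/-- For `z sᵗ = 0` and an index `k` outside both supports, the dyad `1 + sᵗ z` is the commutator of
`1 + sᵗ e_k` and `1 + e_kᵗ z`. -/
theorem dyad_mem_of_commutator (M : Submonoid (Matrix (Fin n) (Fin n) R)) (s z : Fin n → R)
    (k : Fin n) (hs : s k = 0) (hz : z k = 0) (hzs : z ⬝ᵥ s = 0) (x : R)
    (h1 : ∀ i, i ≠ k → s i ≠ 0 → ∀ c, transvection i k (c * s i) ∈ M)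
    (h2 : ∀ j, k ≠ j → z j ≠ 0 → ∀ c, transvection k j (c * x * z j) ∈ M) :
    1 + vecMulVec s (x • z) ∈ M := by
  -- The last two factors are the inverses of the first two, because `s k = z k = 0`.
  have e : (1 : Matrix (Fin n) (Fin n) R) + vecMulVec s (x • z) =
      (1 + vecMulVec s (Pi.single k 1)) * (1 + vecMulVec (Pi.single k 1) (x • z)) *
      ((1 + vecMulVec s (Pi.single k (-1))) * (1 + vecMulVec (Pi.single k 1) (-x • z))) := by
    simp only [add_mul, mul_add, vecMulVec_mul_vecMulVec, one_mul, mul_one]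
    simp [hs, hz, hzs, Pi.single_neg]
    abel
  have A : ∀ c : R, 1 + vecMulVec s (Pi.single k c) ∈ M := fun c => by
    refine dyad_mem_of_disjoint M _ _ (fun i => ?_) fun i j hij hsi hj => ?_
    · by_cases h : i = k
      · subst h; exact Or.inl hs
      · right; simp [h]
    · by_cases h : j = k
      · subst h
        have := h1 i hij hsi c
        rw [mul_comm] at this
        simpa using this
      · simp [h] at hj
  have B : ∀ c : R, 1 + vecMulVec (Pi.single k 1) ((c * x) • z) ∈ M := fun c => by
    refine dyad_mem_of_disjoint M _ _ (fun i => ?_) fun i j hij hsi hj => ?_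
    · by_cases h : i = k
      · subst h; right; simp [hz]
      · left; simp [h]
    · by_cases h : i = k
      · subst h
        have := h2 j hij (by rintro h0; simp [h0] at hj) c
        simpa using this
      · simp [h] at hsi
  rw [e]
  refine M.mul_mem (M.mul_mem (A _) ?_) (M.mul_mem (A _) ?_)
  · simpa using B 1
  · simpa using B (-1)

theorem exists_ne_ne (hn : 3 ≤ n) (i j : Fin n) : ∃ k, k ≠ i ∧ k ≠ j := by
  classical
  have : ({i, j} : Finset (Fin n)) ≠ Finset.univ := by
    intro h
    have h2 := Finset.card_le_two (a := i) (b := j)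
    rw [h, Finset.card_univ, Fintype.card_fin] at h2
    omega
  by_contra! hc
  refine this (Finset.eq_univ_iff_forall.2 fun k => ?_)
  by_cases hk : k = i
  · simp [hk]
  · simp [hc k hk]

theorem one_ne_zero_fin [NeZero n] (hn : 3 ≤ n) : (1 : Fin n) ≠ 0 := by
  have : Nontrivial (Fin n) := Fin.nontrivial_iff_two_le.2 (by omega)
  obtain ⟨m, rfl⟩ : ∃ m, n = m + 2 := ⟨n - 2, by omega⟩
  intro h
  have := congrArg Fin.val h
  simp at this

end Dyads

/-! ### Elementary moves on a single row. -/

section RowEquivalence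

variable {n : ℕ} {A : Type*} [CommRing A]

/-- Two rows in the same orbit of `E_n(A)`. -/
def RowEquiv (v w : Fin n → A) : Prop :=
  ∃ g ∈ elementary n A, v ᵥ* (g : Matrix (Fin n) (Fin n) A) = w

theorem RowEquiv.refl (v : Fin n → A) : RowEquiv v v := ⟨1, one_mem _, by simp⟩

theorem RowEquiv.symm {v w : Fin n → A} : RowEquiv v w → RowEquiv w v := by
  rintro ⟨g, hg, h⟩
  refine ⟨g⁻¹, inv_mem hg, ?_⟩
  rw [← h, Matrix.vecMul_vecMul, ← Units.val_mul, mul_inv_cancel]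
  simp

theorem RowEquiv.trans {u v w : Fin n → A} : RowEquiv u v → RowEquiv v w → RowEquiv u w := by
  rintro ⟨g, hg, h⟩ ⟨k, hk, h'⟩
  exact ⟨g * k, mul_mem hg hk, by rw [Units.val_mul, ← Matrix.vecMul_vecMul, h, h']⟩

theorem RowEquiv.isUnimodular {v w : Fin n → A} (h : RowEquiv v w) (hv : IsUnimodular v) :
    IsUnimodular w := by
  obtain ⟨g, -, rfl⟩ := h
  obtain ⟨u, hu⟩ := hv
  refine ⟨(g⁻¹ : GL (Fin n) A).val *ᵥ u, ?_⟩
  rw [dotProduct_mulVec, vecMul_vecMul, ← Units.val_mul, mul_inv_cancel]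
  simpa using hu

theorem RowEquiv.of_matrices {v : Fin n → A} {M : Matrix (Fin n) (Fin n) A}
    (hM : M ∈ matrices (elementary n A)) : RowEquiv v (v ᵥ* M) := by
  obtain ⟨g, hg, rfl⟩ := hM
  exact ⟨g, hg, rfl⟩

theorem RowEquiv.add_mul (v : Fin n → A) {i j : Fin n} (h : i ≠ j) (c : A) :
    RowEquiv v (Function.update v j (v j + v i * c)) := by
  rw [← vecMul_transvection]
  exact .of_matrices (transvection_mem_matrices h c)

theorem RowEquiv.of_eq_add_mul {v w : Fin n → A} {i j : Fin n} (h : i ≠ j) (c : A)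
    (hj : w j = v j + v i * c) (hw : ∀ k, k ≠ j → w k = v k) : RowEquiv v w := by
  convert RowEquiv.add_mul v h c using 1
  ext k
  by_cases hk : k = j
  · subst hk; simpa using hj
  · simpa [hk] using hw k hk

/-- Adding to a coordinate a combination of the other ones. -/
theorem RowEquiv.of_eq_add_sum {v w : Fin n → A} {j : Fin n} (c : Fin n → A)
    (hj : w j = v j + ∑ i ∈ Finset.univ.erase j, v i * c i) (hw : ∀ k, k ≠ j → w k = v k) :
    RowEquiv v w := by
  classical
  have h := dyad_mem_of_disjoint (matrices (elementary n A)) (Function.update c j 0)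
    (Pi.single j 1) (fun i => by by_cases h : i = j <;> simp [h])
    fun i k hik _ _ => transvection_mem_matrices hik _
  convert RowEquiv.of_matrices (v := v) h using 1
  rw [vecMul_dyad]
  have hs : v ⬝ᵥ Function.update c j 0 = ∑ i ∈ Finset.univ.erase j, v i * c i := by
    rw [dotProduct, ← Finset.add_sum_erase _ _ (Finset.mem_univ j)]
    simp only [Function.update_self, mul_zero, zero_add]
    refine Finset.sum_congr rfl fun i hi => ?_
    rw [Function.update_of_ne (Finset.ne_of_mem_erase hi)]
  ext k
  by_cases hk : k = j
  · subst hk; simp [hj, hs]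
  · simp [hk, hw k hk]

/-- A factor `t` that is invertible modulo `u i` may be moved from one coordinate to another. -/
theorem RowEquiv.move_factor (u : Fin n → A) {i j k : Fin n} (hij : i ≠ j) (hik : i ≠ k)
    (hjk : j ≠ k) (t s m : A) (h : t * s = 1 + u i * m) :
    RowEquiv (Function.update u j (t * u j)) (Function.update u k (t * u k)) := by
  have jk : ∀ p q c d, RowEquiv (Function.update (Function.update u j p) k q)
      (Function.update (Function.update u j p) k (q + p * c + u i * d)) := fun p q c d => by
    refine RowEquiv.trans (v := Function.update (Function.update u j p) k (q + p * c)) ?_ ?_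
    · refine RowEquiv.of_eq_add_mul hjk c ?_ fun a ha => ?_
      · simp [hjk]
      · simp [ha]
    · refine RowEquiv.of_eq_add_mul hik d ?_ fun a ha => ?_
      · simp [hik, hij]
      · simp [ha]
  have kj : ∀ p q c d, RowEquiv (Function.update (Function.update u j p) k q)
      (Function.update (Function.update u j (p + q * c + u i * d)) k q) := fun p q c d => by
    refine RowEquiv.trans (v := Function.update (Function.update u j (p + q * c)) k q) ?_ ?_
    · refine RowEquiv.of_eq_add_mul hjk.symm c ?_ fun a ha => ?_
      · simp [hjk]
      · by_cases hak : a = k <;> simp [ha, hak]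
    · refine RowEquiv.of_eq_add_mul hij d ?_ fun a ha => ?_
      · simp [hik, hij, hjk]
      · by_cases hak : a = k <;> simp [ha, hak]
  have e1 : Function.update u j (t * u j) =
      Function.update (Function.update u j (t * u j)) k (u k) := by
    ext a; by_cases hak : a = k <;> simp [hak, hjk.symm]
  have e2 : Function.update u k (t * u k) =
      Function.update (Function.update u j (u j)) k (t * u k) := by simp
  rw [e1, e2]
  have jk' : ∀ p q q' c d, q' = q + p * c + u i * d →
      RowEquiv (Function.update (Function.update u j p) k q)
        (Function.update (Function.update u j p) k q') := fun p q q' c d h => h ▸ jk p q c d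
  have kj' : ∀ p q p' c d, p' = p + q * c + u i * d →
      RowEquiv (Function.update (Function.update u j p) k q)
        (Function.update (Function.update u j p') k q) := fun p q p' c d h => h ▸ kj p q c d
  -- Modulo `u i`, `s` inverts `t`, and this is the Whitehead factorization of `diag(t⁻¹, t)`. The
  -- pair of coordinates `(j, k)` runs through `(t u_j, u_k + u_j)`, `(-t u_k, u_k + u_j)`, `(-t
  -- u_k, u_j)`, `(u_j - t u_k, u_j)`, `(u_j - t u_k, t u_k)`, `(u_j, t u_k)`; the terms in `m`
  -- absorb the error `u i * m`.
  refine (jk' _ _ (u k + u j) s (-(m * u j)) (by linear_combination (-u j) * h)).trans ?_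
  refine (kj' _ _ (-(t * u k)) (-t) 0 (by ring)).trans ?_
  refine (jk' _ _ (u j) s (m * u k) (by linear_combination (u k) * h)).trans ?_
  refine (kj' _ _ (u j - t * u k) 1 0 (by ring)).trans ?_
  refine (jk' _ _ (t * u k) (-1) 0 (by ring)).trans ?_
  exact kj' _ _ _ 1 0 (by ring)

/-- If `u wᵗ = 1` and `A u i` contains `(b w j)²` and `b w j u k`, then adding `b` to the coordinate
`u j` does not change the orbit. -/
theorem RowEquiv.add_of_sq_mem (u w : Fin n → A) (hw : u ⬝ᵥ w = 1) {i j k : Fin n} (hij : i ≠ j)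
    (hik : i ≠ k) (hjk : j ≠ k) (b m c : A) (hm : (b * w j) ^ 2 = u i * m)
    (hc : b * w j * u k = u i * c) : RowEquiv u (Function.update u j (u j + b)) := by
  have hsum : ∑ l ∈ Finset.univ.erase j, u l * w l = 1 - u j * w j := by
    rw [← hw, dotProduct, ← Finset.add_sum_erase _ _ (Finset.mem_univ j)]
    ring
  -- Writing `b = b (u ⬝ᵥ w)` shows that `u j + b` differs from `(1 + b w_j) u j` by a combination
  -- of the other coordinates.
  have h1 : RowEquiv (Function.update u j ((1 + b * w j) * u j))
      (Function.update u j (u j + b)) := by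
    refine RowEquiv.of_eq_add_sum (j := j) (fun l => b * w l) ?_ fun l hl => by simp [hl]
    have : ∑ l ∈ Finset.univ.erase j, Function.update u j ((1 + b * w j) * u j) l * (b * w l) =
        b * ∑ l ∈ Finset.univ.erase j, u l * w l := by
      rw [Finset.mul_sum]
      refine Finset.sum_congr rfl fun l hl => ?_
      rw [Function.update_of_ne (Finset.ne_of_mem_erase hl)]
      ring
    rw [this, hsum]
    simp only [Function.update_self]
    ring
  -- Modulo `u i` the element `b * w j` has square zero, so `1 - b * w j` inverts `1 + b * w j`.
  have h2 := RowEquiv.move_factor u hij hik hjk (1 + b * w j) (1 - b * w j) (-m)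
    (by linear_combination -hm)
  have h3 : RowEquiv u (Function.update u k ((1 + b * w j) * u k)) := by
    refine RowEquiv.of_eq_add_mul hik c ?_ fun l hl => by simp [hl]
    simp only [Function.update_self]
    linear_combination hc
  exact h3.trans (h2.symm.trans h1)

end RowEquivalence

/-! ### Generators for the relative elementary group. -/

section Suslin

variable {n : ℕ} [NeZero n] {R : Type*} [CommRing R]

/-- A Suslin-type lemma: for `c` unimodular, `r cᵗ = 0` and `x ∈ I`, the matrix `1 + cᵗ (x r)` lies
in any monoid of matrices containing the transvections `E_{ij}(a)`, `i ≠ 1`, `a ∈ R`, and `E_{1j}(y)`,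
`y ∈ I`. -/
theorem dyad_mem_of_orthogonal (hn : 3 ≤ n) (I : Ideal R)
    (M : Submonoid (Matrix (Fin n) (Fin n) R))
    (hM : ∀ i j : Fin n, i ≠ j → ∀ a : R, i ≠ 0 ∨ a ∈ I → transvection i j a ∈ M)
    (c d r : Fin n → R) (hd : d ⬝ᵥ c = 1) (hr : r ⬝ᵥ c = 0) {x : R} (hx : x ∈ I) :
    1 + vecMulVec c (x • r) ∈ M := by
  -- Koszul relations: `d ⬝ᵥ c = 1` and `r ⬝ᵥ c = 0` express `r` through the vectors `c_p e_q - c_q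
  -- e_p`, each orthogonal to `c`.
  have hsum : x • r = ∑ p : Fin n × Fin n,
      (x * (r p.2 * d p.1)) • (c p.1 • Pi.single p.2 (1 : R) - c p.2 • Pi.single p.1 (1 : R)) := by
    rw [Fintype.sum_prod_type]
    ext l
    simp only [Pi.smul_apply, Finset.sum_apply, Pi.sub_apply, smul_eq_mul, mul_sub,
      Finset.sum_sub_distrib]
    have e1 : ∑ i, ∑ j, x * (r j * d i) * (c i * (Pi.single j (1 : R) : Fin n → R) l) =
        x * r l * (d ⬝ᵥ c) := by
      simp only [dotProduct, Finset.mul_sum, Pi.single_apply]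
      refine Finset.sum_congr rfl fun i _ => ?_
      simp
      ring
    have e2 : ∑ i, ∑ j, x * (r j * d i) * (c j * (Pi.single i (1 : R) : Fin n → R) l) =
        x * d l * (r ⬝ᵥ c) := by
      rw [Finset.sum_comm]
      simp only [dotProduct, Finset.mul_sum, Pi.single_apply]
      refine Finset.sum_congr rfl fun i _ => ?_
      simp
      ring
    rw [e1, e2, hd, hr]
    ring
  rw [hsum]
  refine dyad_sum_right_mem M _ _ _ (fun p _ => ?_) fun p _ => ?_
  · simp
    ring
  obtain ⟨i, j⟩ := p
  have hl : x * (r j * d i) ∈ I := I.mul_mem_right _ hx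
  generalize x * (r j * d i) = l at hl
  simp only
  by_cases hij : i = j
  · subst hij; simp [M.one_mem]
  set z : Fin n → R := c i • Pi.single j (1 : R) - c j • Pi.single i (1 : R) with hz
  set s : Fin n → R := c i • Pi.single i (1 : R) + c j • Pi.single j (1 : R) with hs
  have hzs : z ⬝ᵥ s = 0 := by
    simp [hz, hs, hij, Ne.symm hij]
    ring
  have hz0 : ∀ k, k ≠ i → k ≠ j → z k = 0 := fun k hi hj => by simp [hz, hi, hj]
  have hs0 : ∀ k, k ≠ i → k ≠ j → s k = 0 := fun k hi hj => by simp [hs, hi, hj]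
  have hcs : ∀ k, k = i ∨ k = j → (c - s) k = 0 := by
    rintro k (rfl | rfl)
    · simp [hs, hij]
    · simp [hs, Ne.symm hij]
  have hc : c = (c - s) + s := by simp
  -- Split `c` into its part `s` on `{i, j}` and the rest. The rest has support disjoint from `z`;
  -- for `s` a third index gives a commutator.
  rw [hc, ← dyad_mul_dyad_same_right _ _ _ (by simp [hzs])]
  refine M.mul_mem ?_ ?_
  · refine dyad_mem_of_disjoint M _ _ (fun k => ?_) fun k k' hk _ _ =>
      hM _ _ hk _ (Or.inr (I.mul_mem_left _ (I.mul_mem_right _ hl)))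
    by_cases hk : k = i ∨ k = j
    · exact Or.inl (hcs k hk)
    · right
      simp [hz0 k (fun h => hk (Or.inl h)) (fun h => hk (Or.inr h))]
  · obtain ⟨k, hki, hkj⟩ := exists_ne_ne hn i j
    -- Only transvections with row index `0` need a coefficient in `I`. For `k = 0` these are the
    -- factors `E_{kj}`, so `l` stays with `z`; for `k ≠ 0` they can only occur among the `E_{ik}`,
    -- so `l` moves to `s`.
    by_cases hk : k = 0
    · subst hk
      exact dyad_mem_of_commutator M s z 0 (hs0 0 hki hkj) (hz0 0 hki hkj) hzs l
        (fun a ha _ b => hM _ _ ha _ (Or.inl ha))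
        (fun a ha _ b => hM _ _ ha _ (Or.inr (I.mul_mem_right _ (I.mul_mem_left _ hl))))
    · have e : vecMulVec s (l • z) = vecMulVec (l • s) ((1 : R) • z) := by
        rw [one_smul, vecMulVec_smul, smul_vecMulVec]
      rw [e]
      exact dyad_mem_of_commutator M (l • s) z k (by simp [hs0 k hki hkj]) (hz0 k hki hkj)
        (by simp [hzs]) 1
        (fun a ha _ b => hM _ _ ha _ (Or.inr (I.mul_mem_left _ (I.mul_mem_right _ hl))))
        (fun a ha _ b => hM _ _ ha _ (Or.inl hk))

/-- `E_n(R, I)` is contained in every monoid containing the transvections `E_{ij}(a)`, `i ≠ 1`,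
`a ∈ R`, and `E_{1j}(y)`, `y ∈ I`. -/
theorem elementaryRel_le_of_transvection_mem (hn : 3 ≤ n) (I : Ideal R)
    (M : Submonoid (Matrix (Fin n) (Fin n) R))
    (hM : ∀ i j : Fin n, i ≠ j → ∀ a : R, i ≠ 0 ∨ a ∈ I → transvection i j a ∈ M)
    {g : GL (Fin n) R} (hg : g ∈ elementaryRel n R I) :
    (g : Matrix (Fin n) (Fin n) R) ∈ M := by
  have h10 : (1 : Fin n) ≠ 0 := one_ne_zero_fin hn
  have conj : ∀ (h : GL (Fin n) R) (x : R), x ∈ I →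
      (h : Matrix (Fin n) (Fin n) R) * transvection 1 0 x * (h⁻¹ : GL (Fin n) R).val ∈ M := by
    intro h x hx
    have hh : (h⁻¹ : GL (Fin n) R).val * h.val = 1 := by simp
    -- The conjugate is a dyad built from column `1` of `h` and row `0` of `h⁻¹`; row `1` of `h⁻¹`
    -- is the required mate of that column.
    have key := dyad_mem_of_orthogonal hn I M hM (h.val *ᵥ Pi.single 1 1)
      (Pi.single 1 1 ᵥ* (h⁻¹ : GL (Fin n) R).val) (Pi.single 0 1 ᵥ* (h⁻¹ : GL (Fin n) R).val)
      (by rw [dotProduct_mulVec, vecMul_vecMul, hh]; simp)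
      (by rw [dotProduct_mulVec, vecMul_vecMul, hh]; simp [h10]) hx
    convert key using 1
    have e : (Pi.single 0 x : Fin n → R) = x • Pi.single 0 1 := by
      ext a; simp [Pi.single_apply]
    rw [transvection_eq_dyad, mul_add, add_mul, mul_vecMulVec, vecMulVec_mul, e, smul_vecMul]
    simp
  obtain ⟨g, hg, rfl⟩ := hg
  -- `M` is only a monoid, so the induction carries inverses along.
  suffices h : ((g : GL (Fin n) R) : Matrix (Fin n) (Fin n) R) ∈ M ∧
      ((g⁻¹ : elementary n R) : GL (Fin n) R).val ∈ M from h.1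
  replace hg : g ∈ Subgroup.normalClosure _ := hg
  unfold Subgroup.normalClosure at hg
  induction hg using Subgroup.closure_induction with
  | one => simp [M.one_mem]
  | mul a b _ _ ha hb =>
    refine ⟨?_, ?_⟩
    · simpa using M.mul_mem ha.1 hb.1
    · simpa using M.mul_mem hb.2 ha.2
  | inv a _ ha => exact ⟨ha.2, by simpa using ha.1⟩
  | mem g hg =>
    obtain ⟨t, ⟨x, hx, ht⟩, hc⟩ := Group.mem_conjugatesOfSet_iff.1 hg
    obtain ⟨h, rfl⟩ := isConj_iff.1 hc
    have ht' : (t : GL (Fin n) R) = elemUnit h10 x := Units.ext ht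
    refine ⟨?_, ?_⟩
    · simpa [ht] using conj h x hx
    · have := conj h (-x) (I.neg_mem hx)
      simp only [_root_.mul_inv_rev, inv_inv, Subgroup.coe_mul, Units.val_mul, Subgroup.coe_inv,
        ht']
      rw [← mul_assoc]
      exact this

end Suslin

/-! ### Lifting rows and their orbits along an excision map. -/

section Lifting

variable {n : ℕ} [NeZero n] {A R : Type*} [CommRing A] [CommRing R]

/-- A ring homomorphism `φ : A → R` restricting to a bijection of the ideal `J` onto the
ideal `I`. -/
structure IsExcision (φ : A →+* R) (J : Ideal A) (I : Ideal R) : Prop where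
  le : J ≤ I.comap φ
  inj : ∀ x ∈ J, φ x = 0 → x = 0
  surj : ∀ y ∈ I, ∃ x ∈ J, φ x = y

theorem IsExcision.eq_of_map_eq {φ : A →+* R} {J : Ideal A} {I : Ideal R}
    (h : IsExcision φ J I) {x y : A} (hxy : x - y ∈ J) (e : φ x = φ y) : x = y :=
  sub_eq_zero.1 (h.inj _ hxy (by simp [e]))

/-- A row of `Um_n(R, I)` has a mate congruent to `e₁` modulo `I`. -/
theorem exists_mate {I : Ideal R} {v : Fin n → R} (hv : v ∈ UmRel n R I) :
    ∃ w : Fin n → R, v ⬝ᵥ w = 1 ∧ w 0 - 1 ∈ I ∧ ∀ i, i ≠ 0 → w i ∈ I := by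
  obtain ⟨⟨w, hw⟩, h0, hi⟩ := hv
  have hsum : v ⬝ᵥ w = v 0 * w 0 + ∑ i ∈ Finset.univ.erase 0, v i * w i :=
    (Finset.add_sum_erase _ _ (Finset.mem_univ _)).symm
  set q := ∑ i ∈ Finset.univ.erase (0 : Fin n), v i * w i with hq
  have hqI : q ∈ I := I.sum_mem fun i hi' => I.mul_mem_right _ (hi i (Finset.ne_of_mem_erase hi'))
  rw [hw] at hsum
  -- With `v 0 * w 0 = 1 - q`, the product is `(1 - q)(1 + q) + q² = 1`.
  refine ⟨fun i => if i = 0 then w 0 + w 0 * q else w i * q, ?_, ?_, fun i h => ?_⟩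
  · rw [dotProduct, ← Finset.add_sum_erase _ _ (Finset.mem_univ 0)]
    have : ∑ i ∈ Finset.univ.erase (0 : Fin n),
        v i * (if i = 0 then w 0 + w 0 * q else w i * q) = q * q := by
      rw [hq, Finset.sum_mul]
      refine Finset.sum_congr rfl fun i hi => ?_
      rw [if_neg (Finset.ne_of_mem_erase hi)]
      ring
    rw [this, if_pos rfl]
    linear_combination -(1 + q) * hsum
  · simp only [if_pos]
    have : w 0 + w 0 * q - 1 = w 0 * q - w 0 * (v 0 - 1) - q := by linear_combination -hsum
    rw [this]
    exact I.sub_mem (I.sub_mem (I.mul_mem_left _ hqI) (I.mul_mem_left _ h0)) hqI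
  · simp only [if_neg h]
    exact I.mul_mem_left _ hqI

variable {φ : A →+* R} {J : Ideal A} {I : Ideal R}

theorem IsExcision.exists_row (h : IsExcision φ J I) {v : Fin n → R} (h0 : v 0 - 1 ∈ I)
    (hi : ∀ i, i ≠ 0 → v i ∈ I) :
    ∃ u : Fin n → A, φ ∘ u = v ∧ u 0 - 1 ∈ J ∧ ∀ i, i ≠ 0 → u i ∈ J := by
  have : ∀ i, ∃ x : A, φ x = v i ∧ (if i = 0 then x - 1 ∈ J else x ∈ J) := fun i => by
    by_cases hi0 : i = 0
    · subst hi0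
      obtain ⟨x, hx, e⟩ := h.surj _ h0
      exact ⟨1 + x, by simp [e], by simpa⟩
    · obtain ⟨x, hx, e⟩ := h.surj _ (hi i hi0)
      exact ⟨x, e, by simpa [hi0]⟩
  choose u hu hu' using this
  exact ⟨u, funext hu, by simpa using hu' 0, fun i hi0 => by simpa [hi0] using hu' i⟩

theorem IsExcision.row_ext (h : IsExcision φ J I) {u v : Fin n → A} (hu0 : u 0 - 1 ∈ J)
    (hu : ∀ i, i ≠ 0 → u i ∈ J) (hv0 : v 0 - 1 ∈ J) (hv : ∀ i, i ≠ 0 → v i ∈ J)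
    (e : φ ∘ u = φ ∘ v) : u = v := by
  ext i
  refine h.eq_of_map_eq ?_ (congrFun e i)
  by_cases hi : i = 0
  · subst hi
    simpa using J.sub_mem hu0 hv0
  · exact J.sub_mem (hu i hi) (hv i hi)

/-- A mate of `φ ∘ u` congruent to `e₁` lifts to a row whose product with `u` is `1` modulo `J`; the
error in `J` maps to `0`, hence vanishes. -/
theorem IsExcision.mem_umRel (h : IsExcision φ J I) {u : Fin n → A} (hu0 : u 0 - 1 ∈ J)
    (hu : ∀ i, i ≠ 0 → u i ∈ J) (hU : IsUnimodular (φ ∘ u)) : u ∈ UmRel n A J := by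
  refine ⟨?_, hu0, hu⟩
  have hm : φ ∘ u ∈ UmRel n R I := ⟨hU, by simpa using h.le hu0, fun i hi => h.le (hu i hi)⟩
  obtain ⟨w, hw, hw0, hwi⟩ := exists_mate hm
  obtain ⟨w', rfl, hw0', hwi'⟩ := h.exists_row hw0 hwi
  refine ⟨w', h.eq_of_map_eq ?_ (by rw [RingHom.map_dotProduct, hw, map_one])⟩
  rw [dotProduct, ← Finset.add_sum_erase _ _ (Finset.mem_univ 0)]
  have e : ∀ q, u 0 * w' 0 + q - 1 = u 0 * (w' 0 - 1) + (u 0 - 1) + q := fun q => by ring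
  rw [e]
  exact J.add_mem (J.add_mem (J.mul_mem_left _ hw0') hu0)
    (J.sum_mem fun i hi => J.mul_mem_right _ (hu i (Finset.ne_of_mem_erase hi)))

theorem IsExcision.exists_umRel (h : IsExcision φ J I) {v : Fin n → R} (hv : v ∈ UmRel n R I) :
    ∃ u ∈ UmRel n A J, φ ∘ u = v := by
  obtain ⟨u, rfl, hu0, hu⟩ := h.exists_row hv.2.1 hv.2.2
  exact ⟨u, h.mem_umRel hu0 hu hv.1, rfl⟩

/-- The matrices over `R` acting on `Um_n(R, I)` within the orbits of `E_n(A)` on the lifted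
rows. -/
def orbitMonoid (n : ℕ) [NeZero n] (φ : A →+* R) (J : Ideal A) :
    Submonoid (Matrix (Fin n) (Fin n) R) where
  carrier := {M | ∀ v ∈ UmRel n A J, ∃ v' ∈ UmRel n A J, φ ∘ v' = (φ ∘ v) ᵥ* M ∧ RowEquiv v v'}
  one_mem' := fun v hv => ⟨v, hv, by simp, .refl v⟩
  mul_mem' := by
    intro M N hM hN v hv
    obtain ⟨v', hv', e, h⟩ := hM v hv
    obtain ⟨v'', hv'', e', h'⟩ := hN v' hv'
    exact ⟨v'', hv'', by rw [e', e, vecMul_vecMul], h.trans h'⟩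

/-- The increment `φ (v i) * a` lies in `I` and lifts to some `b ∈ J`. When `i ≠ 0`, `b` need not be
a multiple of `v i` in `A`, but its square and its products with elements of `J` become such
multiples after `a` is absorbed into `I`. That is enough for `RowEquiv.add_of_sq_mem`. -/
theorem IsExcision.transvection_mem_orbitMonoid (h : IsExcision φ J I) (hn : 3 ≤ n)
    {i j : Fin n} (hij : i ≠ j) (a : R) (ha : i ≠ 0 ∨ a ∈ I) :
    transvection i j a ∈ orbitMonoid n φ J := by
  intro v hv
  suffices H : ∃ b ∈ J, φ b = φ (v i) * a ∧ RowEquiv v (Function.update v j (v j + b)) by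
    obtain ⟨b, hb, e, he⟩ := H
    refine ⟨_, ⟨he.isUnimodular hv.1, ?_, fun k hk => ?_⟩, ?_, he⟩
    · by_cases hj : 0 = j
      · subst hj
        have : v 0 + b - 1 = (v 0 - 1) + b := by ring
        simpa [this] using J.add_mem hv.2.1 hb
      · simpa [hj] using hv.2.1
    · by_cases hj : k = j
      · subst hj
        simpa using J.add_mem (hv.2.2 k hk) hb
      · simpa [hj] using hv.2.2 k hk
    · rw [vecMul_transvection]
      ext k
      by_cases hj : k = j
      · subst hj; simp [e]
      · simp [hj]
  by_cases hi : i = 0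
  · obtain ⟨y, hy, rfl⟩ := h.surj a (ha.resolve_left (not_not.2 hi))
    exact ⟨v i * y, J.mul_mem_left _ hy, by simp, .add_mul v hij y⟩
  · obtain ⟨w, hw, hw0, hwi⟩ := exists_mate hv
    obtain ⟨k, hki, hkj⟩ := exists_ne_ne hn i j
    have hvi : v i ∈ J := hv.2.2 i hi
    obtain ⟨b, hb, eb⟩ := h.surj (φ (v i) * a) (I.mul_mem_right _ (h.le hvi))
    obtain ⟨m, hm, em⟩ := h.surj (φ (v i) * (a * φ (w j)) ^ 2) (I.mul_mem_right _ (h.le hvi))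
    -- At least one of `j`, `k` is nonzero, and both `v` and its mate `w` are congruent to `e₁`.
    have hc' : w j * v k ∈ J := by
      by_cases hj : j = 0
      · exact J.mul_mem_left _ (hv.2.2 k (hj ▸ hkj))
      · exact J.mul_mem_right _ (hwi j hj)
    obtain ⟨c, hc, ec⟩ := h.surj (φ (w j * v k) * a) (I.mul_mem_right _ (h.le hc'))
    refine ⟨b, hb, eb, RowEquiv.add_of_sq_mem v w hw hij hki.symm hkj.symm b m c ?_ ?_⟩
    · refine h.eq_of_map_eq (J.sub_mem ?_ (J.mul_mem_left _ hm)) ?_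
      · exact J.pow_mem_of_mem (J.mul_mem_right _ hb) 2 (by norm_num)
      · simp only [map_mul, map_pow, eb, em]
        ring
    · refine h.eq_of_map_eq (J.sub_mem ?_ (J.mul_mem_left _ hc)) ?_
      · exact J.mul_mem_right _ (J.mul_mem_right _ hb)
      · simp only [map_mul, eb, ec]
        ring

/-- Rows over `A` whose images in `Um_n(R, I)` have the same orbit under `E_n(R, I)` have the same
orbit under `E_n(A)`. -/
theorem IsExcision.rowEquiv_of_map (h : IsExcision φ J I) (hn : 3 ≤ n) {v w : Fin n → A}
    (hv : v ∈ UmRel n A J) (hw : w ∈ UmRel n A J) {g : GL (Fin n) R}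
    (hg : g ∈ elementaryRel n R I) (e : (φ ∘ v) ᵥ* (g : Matrix (Fin n) (Fin n) R) = φ ∘ w) :
    RowEquiv v w := by
  have hM := elementaryRel_le_of_transvection_mem hn I (orbitMonoid n φ J)
    (fun i j hij a ha => h.transvection_mem_orbitMonoid hn hij a ha) hg
  obtain ⟨v', hv', e', h'⟩ := hM v hv
  rwa [← h.row_ext hv'.2.1 hv'.2.2 hw.2.1 hw.2.2 (e'.trans e)]

end Lifting

/-! ### Transitivity and stabilizers for `E_n(ℤ)`. -/

section Integers

variable {n : ℕ}

/-- The subgroup of `GL_n(R)` fixing all rows in a set. -/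
def rowStabilizer {R : Type*} [CommRing R] (s : Set (Fin n → R)) : Subgroup (GL (Fin n) R) where
  carrier := {g | ∀ v ∈ s, v ᵥ* (g : Matrix (Fin n) (Fin n) R) = v}
  one_mem' := by simp
  mul_mem' := by
    intro a b ha hb v hv
    rw [Units.val_mul, ← vecMul_vecMul, ha v hv, hb v hv]
  inv_mem' := by
    intro a ha v hv
    conv_lhs => rw [← ha v hv]
    rw [vecMul_vecMul, ← Units.val_mul, mul_inv_cancel]
    simp

theorem mem_rowStabilizer {R : Type*} [CommRing R] {s : Set (Fin n → R)} {g : GL (Fin n) R} :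
    g ∈ rowStabilizer s ↔ ∀ v ∈ s, v ᵥ* (g : Matrix (Fin n) (Fin n) R) = v := Iff.rfl

theorem elemUnit_mem_rowStabilizer {R : Type*} [CommRing R] {s : Set (Fin n → R)} {i j : Fin n}
    (h : i ≠ j) (c : R) (hs : ∀ v ∈ s, v i = 0) : elemUnit h c ∈ rowStabilizer s := by
  intro v hv
  simp [vecMul_transvection, hs v hv]

theorem elementary_le_det_ker {R : Type*} [CommRing R] :
    elementary n R ≤ (GeneralLinearGroup.det (n := Fin n) (R := R)).ker := by
  refine (Subgroup.closure_le _).2 ?_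
  rintro g ⟨i, j, hij, c, hc⟩
  refine Units.ext ?_
  simp [hc, det_transvection_of_ne i j hij]

/-- The Euclidean algorithm on the coordinates in `S` of an integral row. -/
theorem exists_reduce_row (S : Finset (Fin n)) {k l : Fin n} (hk : k ∈ S) (hl : l ∈ S)
    (hkl : k ≠ l) (T : Subgroup (GL (Fin n) ℤ))
    (hT : ∀ i ∈ S, ∀ j ∈ S, ∀ h : i ≠ j, ∀ c, elemUnit h c ∈ T) (v : Fin n → ℤ)
    (hv : ∀ d : ℤ, (∀ j ∈ S, d ∣ v j) → d ∣ 1) :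
    ∃ g ∈ T, ∀ j ∈ S, (v ᵥ* (g : Matrix (Fin n) (Fin n) ℤ)) j = if j = k then 1 else 0 := by
  induction hN : ∑ j ∈ S, (v j).natAbs using Nat.strong_induction_on generalizing v with
  | _ N ih =>
  subst hN
  have step : ∀ i ∈ S, ∀ j ∈ S, ∀ h : i ≠ j, v i ≠ 0 → (v i).natAbs ≤ (v j).natAbs →
      ∃ g ∈ T, ∀ j ∈ S, (v ᵥ* (g : Matrix (Fin n) (Fin n) ℤ)) j = if j = k then 1 else 0 := by
    intro i hi j hj hij h0 hle
    obtain ⟨c, hc⟩ : ∃ c : ℤ, (v j + v i * c).natAbs < (v j).natAbs := by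
      rcases le_total 0 (v i) with hp | hp <;> rcases le_total 0 (v j) with hq | hq
      · exact ⟨-1, by omega⟩
      · exact ⟨1, by omega⟩
      · exact ⟨1, by omega⟩
      · exact ⟨-1, by omega⟩
    have hlt : ∑ a ∈ S, (Function.update v j (v j + v i * c) a).natAbs <
        ∑ a ∈ S, (v a).natAbs := by
      refine Finset.sum_lt_sum (fun a _ => ?_) ⟨j, hj, by simpa using hc⟩
      by_cases ha : a = j
      · subst ha; simpa using hc.le
      · simp [ha]
    obtain ⟨g, hg, hgv⟩ := ih _ hlt (Function.update v j (v j + v i * c)) (fun d hd => by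
      refine hv d fun a ha => ?_
      have hdi : d ∣ v i := by simpa [hij] using hd i hi
      by_cases haj : a = j
      · subst haj
        have := hd a hj
        rw [Function.update_self] at this
        exact (dvd_add_left (hdi.mul_right c)).1 this
      · simpa [haj] using hd a ha) rfl
    refine ⟨elemUnit hij c * g, T.mul_mem (hT i hi j hj hij c) hg, ?_⟩
    rwa [Units.val_mul, coe_elemUnit, ← vecMul_vecMul, vecMul_transvection]
  by_cases hex : ∃ i ∈ S, ∃ j ∈ S, i ≠ j ∧ v i ≠ 0 ∧ v j ≠ 0
  · obtain ⟨i, hi, j, hj, hij, h1, h2⟩ := hex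
    rcases le_total (v i).natAbs (v j).natAbs with h | h
    · exact step i hi j hj hij h1 h
    · exact step j hj i hi hij.symm h2 h
  push Not at hex
  obtain ⟨i, hi, hi0⟩ : ∃ i ∈ S, v i ≠ 0 := by
    by_contra! hc
    have := hv 2 fun j hj => by simp [hc j hj]
    omega
  have hother : ∀ j ∈ S, j ≠ i → v j = 0 := fun j hj hji => hex i hi j hj hji.symm hi0
  have hunit : v i * v i = 1 := by
    have : v i ∣ 1 := hv _ fun j hj => by
      by_cases hji : j = i
      · rw [hji]
      · simp [hother j hj hji]
    rcases Int.isUnit_iff.1 (isUnit_of_dvd_one this) with h | h <;> simp [h]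
  by_cases hik : i = k
  · subst hik
    -- The sole nonzero entry is `ε = ±1`, already in place `k`. The spare place `l` corrects the
    -- sign: `(ε, 0)`, `(ε, 1)`, `(1, 1)`, `(1, 0)`.
    refine ⟨elemUnit hkl (v i) * elemUnit hkl.symm (1 - v i) * elemUnit hkl (-1),
      T.mul_mem (T.mul_mem (hT _ hk _ hl _ _) (hT _ hl _ hk _ _)) (hT _ hk _ hl _ _), ?_⟩
    intro j hj
    simp only [Units.val_mul, coe_elemUnit, ← vecMul_vecMul, vecMul_transvection]
    by_cases hji : j = i
    · subst hji
      simp [hkl, hkl.symm, hunit, hother l hl hkl.symm]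
    · by_cases hjl : j = l
      · subst hjl
        simp [hkl, hkl.symm, hunit, hother j hj hji]
      · simp [hji, hjl, hother j hj hji]
  · refine ⟨elemUnit hik (v i) * elemUnit (Ne.symm hik) (-v i),
      T.mul_mem (hT _ hi _ hk _ _) (hT _ hk _ hi _ _), ?_⟩
    intro j hj
    simp only [Units.val_mul, coe_elemUnit, ← vecMul_vecMul, vecMul_transvection]
    by_cases hji : j = i
    · subst hji
      simp [hik, hunit, hother k hk (Ne.symm hik)]
    · by_cases hjk : j = k
      · subst hjk
        simp [hji, hunit, hother j hj hji]
      · simp [hji, hjk, hother j hj hji]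

/-- `E_n(ℤ)` acts transitively on unimodular rows. -/
theorem exists_elementary_int [NeZero n] (hn : 3 ≤ n) {v : Fin n → ℤ} (hv : IsUnimodular v) :
    ∃ g ∈ elementary n ℤ, v ᵥ* (g : Matrix (Fin n) (Fin n) ℤ) = Pi.single 0 1 := by
  obtain ⟨w, hw⟩ := hv
  obtain ⟨g, hg, h⟩ := exists_reduce_row Finset.univ (Finset.mem_univ 0) (Finset.mem_univ 1)
    (one_ne_zero_fin hn).symm (elementary n ℤ) (fun i _ j _ h c => elemUnit_mem h c) v
    fun d hd => by
      rw [← hw]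
      exact Finset.dvd_sum fun i hi => (hd i hi).mul_right _
  refine ⟨g, hg, ?_⟩
  ext j
  rw [h j (Finset.mem_univ j), Pi.single_apply]

/-- An integral matrix of determinant `1` whose first `k ≥ 1` rows are standard is a product of
transvections `E_{ij}(c)`, `i ≠ 1`. -/
theorem mem_of_rows_eq [NeZero n] (T : Subgroup (GL (Fin n) ℤ))
    (hT : ∀ i j : Fin n, i ≠ 0 → ∀ h : i ≠ j, ∀ c, elemUnit h c ∈ T) (m : ℕ) :
    ∀ k : ℕ, 1 ≤ k → n ≤ k + m → ∀ g : GL (Fin n) ℤ, g ∈ GeneralLinearGroup.det.ker →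
      (∀ a : Fin n, (a : ℕ) < k →
        Pi.single a 1 ᵥ* (g : Matrix (Fin n) (Fin n) ℤ) = Pi.single a 1) → g ∈ T := by
  induction m with
  | zero =>
    intro k _ hk g _ hg
    convert T.one_mem
    ext a b
    have := congrFun (hg a (by omega)) b
    simpa [Matrix.one_apply, Pi.single_apply, eq_comm] using this
  | succ m ih =>
    intro k hk1 hkm g hdet hg
    rcases Nat.lt_or_ge k n with hkn | hkn
    swap
    · exact ih k hk1 (by omega) g hdet hg
    set κ : Fin n := ⟨k, hkn⟩ with hκ
    set std : Set (Fin n → ℤ) := {v | ∃ a : Fin n, (a : ℕ) < k ∧ v = Pi.single a 1} with hstd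
    -- Multiplying by elements of `T'` preserves both the determinant and the first `k` rows.
    set T' : Subgroup (GL (Fin n) ℤ) := T ⊓ GeneralLinearGroup.det.ker ⊓ rowStabilizer std with hT'
    have hgs : g ∈ rowStabilizer std := by
      rintro _ ⟨a, ha, rfl⟩
      exact hg a ha
    have hE : ∀ i j : Fin n, k ≤ (i : ℕ) → ∀ h : i ≠ j, ∀ c, elemUnit h c ∈ T' := by
      intro i j hi h c
      refine ⟨⟨hT i j ?_ h c, elementary_le_det_ker (elemUnit_mem h c)⟩,
        elemUnit_mem_rowStabilizer h c ?_⟩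
      · rintro rfl
        simp at hi
        omega
      · rintro _ ⟨a, ha, rfl⟩
        have : i ≠ a := by rintro rfl; omega
        simp [this]
    set v : Fin n → ℤ := Pi.single κ 1 ᵥ* (g : Matrix (Fin n) (Fin n) ℤ) with hv
    obtain ⟨h, hh, hhv⟩ : ∃ h ∈ T', ∀ j : Fin n, k ≤ (j : ℕ) →
        (v ᵥ* (h : Matrix (Fin n) (Fin n) ℤ)) j = if j = κ then 1 else 0 := by
      rcases Nat.lt_or_ge (k + 1) n with hk2 | hk2
      · set l : Fin n := ⟨k + 1, hk2⟩ with hl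
        have hcop : ∀ d : ℤ, (∀ j ∈ Finset.univ.filter fun j : Fin n => k ≤ (j : ℕ), d ∣ v j) →
            d ∣ 1 := by
          intro d hd
          -- The inverse `g⁻¹` also fixes the first `k` standard rows, so its column `κ` vanishes
          -- above place `k`. Hence the entries of `v` from place `k` on are already coprime.
          have e : v ⬝ᵥ ((g⁻¹ : GL (Fin n) ℤ).val *ᵥ Pi.single κ 1) = 1 := by
            rw [hv, dotProduct_mulVec, vecMul_vecMul, ← Units.val_mul, mul_inv_cancel]
            simp
          rw [← e]
          refine Finset.dvd_sum fun j _ => ?_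
          by_cases hj : k ≤ (j : ℕ)
          · exact (hd j (by simpa using hj)).mul_right _
          · have h1 := (rowStabilizer std).inv_mem hgs (Pi.single j 1) ⟨j, by omega, rfl⟩
            have h2 : ((g⁻¹ : GL (Fin n) ℤ).val *ᵥ Pi.single κ 1) j = 0 := by
              have hjκ : κ ≠ j := by rintro rfl; simp [hκ] at hj
              have := congrFun h1 κ
              simpa [hjκ] using this
            rw [h2]
            simp
        obtain ⟨h, hh, hhv⟩ := exists_reduce_row (Finset.univ.filter fun j : Fin n => k ≤ (j : ℕ))
          (k := κ) (l := l) (by simp [hκ]) (by simp [hl]) (by simp [hκ, hl]) T'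
          (fun i hi j _ hij c => hE i j (by simpa using hi) hij c) v hcop
        exact ⟨h, hh, fun j hj => hhv j (by simpa using hj)⟩
      -- For the last row there is no second place to reduce with. There `g` is lower triangular,
      -- and determinant `1` forces the last diagonal entry.
      · refine ⟨1, T'.one_mem, fun j hj => ?_⟩
        have hjκ : j = κ := by
          ext
          simp [hκ]
          omega
        rw [hjκ]
        have hrow : ∀ a : Fin n, a ≠ κ → ∀ b, g.val a b = if b = a then 1 else 0 := by
          intro a ha b
          have hak : (a : ℕ) < k := by
            rcases Nat.lt_or_ge (a : ℕ) k with h | h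
            · exact h
            · exact absurd (Fin.ext (by simp [hκ]; omega)) ha
          have := congrFun (hg a hak) b
          simpa [Pi.single_apply] using this
        have hd : g.val.det = 1 := congrArg Units.val hdet
        rw [Matrix.det_of_isLowerTriangular g.val] at hd
        · rw [Finset.prod_eq_single κ (fun b _ hb => by simp [hrow b hb]) (by simp)] at hd
          simpa [hv] using hd
        · intro a b hab
          have hab' : a < b := hab
          have : a ≠ κ := by
            intro hak
            have h1 : (a : ℕ) < b := hab'
            have h2 : (a : ℕ) = k := congrArg Fin.val hak
            omega
          simp [hrow a this, hab'.ne']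
    set r := v ᵥ* (h : Matrix (Fin n) (Fin n) ℤ) with hr
    -- This clears the entries of row `κ` before place `k`; since `r κ = 1`, the supports are
    -- disjoint.
    have hmem : 1 + vecMulVec (Pi.single κ 1) (Pi.single κ 1 - r) ∈ matrices T' := by
      refine dyad_mem_of_disjoint _ _ _ (fun i => ?_) fun i j hij hi _ => ?_
      · by_cases hi : i = κ
        · subst hi
          right
          simp [hhv κ le_rfl]
        · left
          simp [hi]
      · have hi : i = κ := by
          by_contra hne
          simp [hne] at hi
        exact ⟨_, hE i j (by simp [hi, hκ]) hij _, rfl⟩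
    obtain ⟨c, hc, hcM⟩ := hmem
    have hT'T : ∀ x ∈ T', x ∈ T := fun x hx => hx.1.1
    suffices hs : g * h * c ∈ T by
      have := T.mul_mem (T.mul_mem hs (T.inv_mem (hT'T c hc))) (T.inv_mem (hT'T h hh))
      simpa [mul_assoc] using this
    refine ih (k + 1) (by omega) (by omega) _
      (mul_mem (mul_mem hdet hh.1.2) hc.1.2) fun a ha => ?_
    rcases Nat.lt_or_ge (a : ℕ) k with hak | hak
    · exact (mul_mem (mul_mem hgs hh.2) hc.2 : g * h * c ∈ rowStabilizer std) _ ⟨a, hak, rfl⟩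
    · have haκ : a = κ := Fin.ext (by simp [hκ]; omega)
      subst haκ
      have hcM' : (c : Matrix (Fin n) (Fin n) ℤ) =
          1 + vecMulVec (Pi.single κ 1) (Pi.single κ 1 - r) := hcM
      rw [Units.val_mul, Units.val_mul, ← vecMul_vecMul, ← vecMul_vecMul, ← hv, ← hr, hcM',
        vecMul_dyad]
      simp [hhv κ le_rfl]

/-- The stabilizer of `e₁` in `E_n(ℤ)` is generated by the transvections `E_{ij}(c)`, `i ≠ 1`. -/
theorem mem_of_elementary_int [NeZero n] (T : Subgroup (GL (Fin n) ℤ))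
    (hT : ∀ i j : Fin n, i ≠ 0 → ∀ h : i ≠ j, ∀ c, elemUnit h c ∈ T) {g : GL (Fin n) ℤ}
    (hg : g ∈ elementary n ℤ)
    (h : Pi.single 0 1 ᵥ* (g : Matrix (Fin n) (Fin n) ℤ) = Pi.single 0 1) : g ∈ T := by
  refine mem_of_rows_eq T hT n 1 le_rfl (by omega) g (elementary_le_det_ker hg) fun a ha => ?_
  have : a = 0 := Fin.ext (by simpa using ha)
  rw [this, h]

end Integers

/-! ### Relative versus absolute orbits over a ring augmented over the integers. -/

section Relative

variable {n : ℕ} [NeZero n] {A : Type*} [CommRing A]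

theorem conj_mem_elementaryRel {J : Ideal A} {g e : GL (Fin n) A} (hg : g ∈ elementary n A)
    (he : e ∈ elementaryRel n A J) : g * e * g⁻¹ ∈ elementaryRel n A J := by
  obtain ⟨e, he, rfl⟩ := he
  have h := Subgroup.normalClosure_normal.conj_mem e he ⟨g, hg⟩
  exact ⟨_, h, by simp⟩

theorem elemUnit_commutator {n : ℕ} {i j k : Fin n} (hik : i ≠ k) (hkj : k ≠ j) (hij : i ≠ j)
    (a b : A) :
    elemUnit hik a * elemUnit hkj b * (elemUnit hik a)⁻¹ * (elemUnit hkj b)⁻¹ =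
      elemUnit hij (a * b) := by
  refine Units.ext ?_
  change transvection i k a * transvection k j b * transvection i k (-a) * transvection k j (-b) =
    transvection i j (a * b)
  simp [transvection, add_mul, mul_add, hik.symm, hkj.symm, hij.symm, ← single_neg]
  abel

/-- `E_n(A, J)` contains all `E_{ij}(x)`, `x ∈ J`. -/
theorem elemUnit_mem_elementaryRel (hn : 3 ≤ n) (J : Ideal A) {i j : Fin n} (h : i ≠ j) {x : A}
    (hx : x ∈ J) : elemUnit h x ∈ elementaryRel n A J := by
  have h10 : (1 : Fin n) ≠ 0 := one_ne_zero_fin hn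
  have base : elemUnit h10 x ∈ elementaryRel n A J :=
    ⟨⟨elemUnit h10 x, elemUnit_mem _ _⟩, Subgroup.subset_normalClosure ⟨x, hx, rfl⟩, rfl⟩
  have right : ∀ {a b c : Fin n} (hab : a ≠ b) (hac : a ≠ c),
      elemUnit hab x ∈ elementaryRel n A J → elemUnit hac x ∈ elementaryRel n A J := by
    intro a b c hab hac hm
    by_cases hbc : b = c
    · subst hbc; exact hm
    have := elemUnit_commutator hab hbc hac x 1
    rw [mul_one] at this
    rw [← this, mul_assoc, mul_assoc, ← mul_assoc (elemUnit hbc 1)]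
    exact mul_mem hm (conj_mem_elementaryRel (elemUnit_mem _ _) (inv_mem hm))
  have left : ∀ {a b c : Fin n} (hac : a ≠ c) (hbc : b ≠ c),
      elemUnit hac x ∈ elementaryRel n A J → elemUnit hbc x ∈ elementaryRel n A J := by
    intro a b c hac hbc hm
    by_cases hba : b = a
    · subst hba; exact hm
    have := elemUnit_commutator hba hac hbc 1 x
    rw [one_mul] at this
    rw [← this]
    exact mul_mem (conj_mem_elementaryRel (elemUnit_mem _ _) hm) (inv_mem hm)
  by_cases hi : i = 0
  -- Row `0` cannot be reached while the column is `0`, so the route is `(1,0)`, `(k,0)`, `(k,j)`,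
  -- `(0,j)`.
  · obtain ⟨k, hk0, hkj⟩ := exists_ne_ne hn 0 j
    exact left hkj h (right hk0 hkj (left h10 hk0 base))
  · exact right hi h (left h10 hi base)

/-- If `π : A → B` has a section `ι`, every element of `E_n(A)` is the product of an element of
`E_n(A, ker π)` and the image of an element of `E_n(B)`. -/
theorem mul_inv_mem_elementaryRel (hn : 3 ≤ n) {B : Type*} [CommRing B] (π : A →+* B)
    (ι : B →+* A) (hπ : ∀ b, π (ι b) = b) {J : Ideal A} (hJ : ∀ x, x ∈ J ↔ π x = 0)
    {g : GL (Fin n) A} (hg : g ∈ elementary n A) :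
    g * (GeneralLinearGroup.map ι (GeneralLinearGroup.map π g))⁻¹ ∈ elementaryRel n A J := by
  unfold elementary at hg
  induction hg using Subgroup.closure_induction with
  | mem g hg =>
    obtain ⟨i, j, hij, c, hc⟩ := hg
    have hg' : g = elemUnit hij c := Units.ext hc
    subst hg'
    convert elemUnit_mem_elementaryRel hn J hij (x := c - ι (π c)) ((hJ _).2 (by simp [hπ]))
      using 1
    rw [mul_inv_eq_iff_eq_mul]
    refine Units.ext ?_
    change transvection i j c = transvection i j _ * ((transvection i j c).map π).map ι
    rw [transvection_map, transvection_map, transvection_mul_transvection_same _ _ hij]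
    simp
  | one => simp [one_mem]
  | mul a b ha _ iha ihb =>
    -- With primes for the images under `ι ∘ π`, `ab(a'b')⁻¹ = a(bb'⁻¹)a⁻¹ · aa'⁻¹`.
    have := mul_mem (conj_mem_elementaryRel ha ihb) iha
    convert this using 1
    simp only [map_mul, _root_.mul_inv_rev]
    group
  | inv a ha iha =>
    have := conj_mem_elementaryRel (inv_mem ha) (inv_mem iha)
    convert this using 1
    simp only [map_inv, _root_.mul_inv_rev]
    group

/-- For `u ≡ e₁` modulo `ker π`, the transvections over `B` fixing `e₁` lift to elements of `E_n(A)`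
fixing `u`. -/
theorem elemUnit_mem_map_stabilizer (hn : 3 ≤ n) {B : Type*} [CommRing B] (π : A →+* B)
    (u : Fin n → A) (hu : π ∘ u = Pi.single 0 1) {i j : Fin n} (hi : i ≠ 0) (h : i ≠ j) (c : A) :
    elemUnit h (π c) ∈
      (elementary n A ⊓ rowStabilizer {u}).map (GeneralLinearGroup.map π) := by
  have hu0 : π (u 0) = 1 := by simpa using congrFun hu 0
  have hui : π (u i) = 0 := by simpa [hi] using congrFun hu i
  -- This lift of `e_i` is orthogonal to `u`, so every `1 + sᵗ z` fixes `u`.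
  set s : Fin n → A := u 0 • Pi.single i 1 - u i • Pi.single 0 1 with hs
  have hus : u ⬝ᵥ s = 0 := by
    simp [hs]
    ring
  have hsk : ∀ k, k ≠ i → k ≠ 0 → s k = 0 := fun k h1 h2 => by simp [hs, h1, h2]
  have hπs : π ∘ s = Pi.single i 1 := by
    ext k
    simp [hs, hu0, hui, Pi.single_apply, apply_ite π]
  suffices H : ∃ z : Fin n → A, π ∘ z = Pi.single j (π c) ∧
      1 + vecMulVec s z ∈ matrices (elementary n A) by
    obtain ⟨z, hz, g, hg, hgM⟩ := H
    have hgM' : (g : Matrix (Fin n) (Fin n) A) = 1 + vecMulVec s z := hgM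
    refine ⟨g, ⟨hg, ?_⟩, Units.ext ?_⟩
    · rintro _ rfl
      rw [hgM', vecMul_dyad, hus]
      simp
    · change (g : Matrix (Fin n) (Fin n) A).map π = transvection i j (π c)
      rw [hgM', transvection_eq_dyad, ← hπs, ← hz]
      ext a b
      simp [Matrix.one_apply, vecMulVec_apply, apply_ite π]
  by_cases hj : j = 0
  · subst hj
    obtain ⟨k, hki, hk0⟩ := exists_ne_ne hn i 0
    -- The plain lift `c e₀` is not orthogonal to `s`. The added term, zero under `π`, makes it so
    -- and permits the commutator through `k`.
    refine ⟨c • (u 0 • Pi.single 0 1 + u i • Pi.single i 1), ?_, ?_⟩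
    · ext k
      simp [hu0, hui, Pi.single_apply, apply_ite π]
    · exact dyad_mem_of_commutator _ s _ k (hsk k hki hk0) (by simp [hki, hk0])
        (by simp [hs, hi, hi.symm]; ring) c (fun a ha _ b => transvection_mem_matrices ha _)
        (fun a ha _ b => transvection_mem_matrices ha _)
  · refine ⟨Pi.single j c, ?_, ?_⟩
    · ext k
      simp [Pi.single_apply, apply_ite π]
    · refine dyad_mem_of_disjoint _ _ _ (fun k => ?_)
        fun a b hab _ _ => transvection_mem_matrices hab _
      by_cases hk : k = j
      · subst hk
        exact Or.inl (hsk k h.symm hj)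
      · right
        simp [hk]

theorem comp_eq_single_of_mem {B : Type*} [CommRing B] {π : A →+* B} {J : Ideal A}
    (hJ : ∀ x, x ∈ J ↔ π x = 0) {v : Fin n → A} (hv : v ∈ UmRel n A J) :
    π ∘ v = Pi.single 0 1 := by
  ext i
  by_cases hi : i = 0
  · subst hi
    have := (hJ _).1 hv.2.1
    rw [map_sub, map_one, sub_eq_zero] at this
    simp [this]
  · simp [hi, (hJ _).1 (hv.2.2 i hi)]

/-- For a ring `A` augmented over `ℤ`, rows of `Um_n(A, J)` in the same orbit of `E_n(A)` are in the
same orbit of `E_n(A, J)`, `J` being the augmentation ideal. -/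
theorem exists_elementaryRel_of_rowEquiv (hn : 3 ≤ n) (π : A →+* ℤ) {J : Ideal A}
    (hJ : ∀ x, x ∈ J ↔ π x = 0) {v w : Fin n → A} (hv : v ∈ UmRel n A J) (hw : w ∈ UmRel n A J)
    (h : RowEquiv v w) :
    ∃ g ∈ elementaryRel n A J, v ᵥ* (g : Matrix (Fin n) (Fin n) A) = w := by
  obtain ⟨g, hg, hgv⟩ := h
  have hπv := comp_eq_single_of_mem hJ hv
  have hfix : Pi.single 0 1 ᵥ* (GeneralLinearGroup.map π g : Matrix (Fin n) (Fin n) ℤ) =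
      Pi.single 0 1 := by
    rw [← hπv, vecMul_map, hgv, comp_eq_single_of_mem hJ hw, hπv]
  -- `θ` fixes `v` and has the same reduction as `g`, so `θ⁻¹ * g` still carries `v` to `w` and
  -- reduces to `1`.
  obtain ⟨θ, ⟨hθ, hθv⟩, hθπ⟩ := mem_of_elementary_int
    ((elementary n A ⊓ rowStabilizer {v}).map (GeneralLinearGroup.map π))
    (fun i j hi hij c => by
      simpa using elemUnit_mem_map_stabilizer hn π v hπv hi hij (c : A))
    (elementary_map π hg) hfix
  refine ⟨θ⁻¹ * g, ?_, ?_⟩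
  · have := mul_inv_mem_elementaryRel hn π (Int.castRingHom A) (by simp) hJ
      (mul_mem (inv_mem hθ) hg)
    simpa [map_mul, hθπ] using this
  · rw [Units.val_mul, ← vecMul_vecMul,
      (mem_rowStabilizer.1 ((rowStabilizer {v}).inv_mem hθv)) v rfl, hgv]

/-- Surjectivity comes from reducing a row to `ℤ` and lifting the integral matrix that moves the
reduction to `e₁`. -/
theorem toMSE_bijective (hn : 3 ≤ n) (π : A →+* ℤ) {J : Ideal A} (hJ : ∀ x, x ∈ J ↔ π x = 0) :
    Function.Bijective (MSERel.toMSE n J) := by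
  refine ⟨?_, ?_⟩
  · rintro ⟨v, hv⟩ ⟨w, hw⟩ h
    exact Quotient.sound (exists_elementaryRel_of_rowEquiv hn π hJ hv hw (Quotient.exact h))
  · rintro ⟨v, hv⟩
    obtain ⟨g, hg, hgv⟩ := exists_elementary_int hn (IsUnimodular.map π hv)
    have hg' := elementary_map (Int.castRingHom A) hg
    set g' := GeneralLinearGroup.map (Int.castRingHom A) g
    have hπg : GeneralLinearGroup.map π g' = g := by
      refine Units.ext ?_
      ext i j
      simp [g']
    have e : RowEquiv v (v ᵥ* (g' : Matrix (Fin n) (Fin n) A)) := ⟨g', hg', rfl⟩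
    have hπ : π ∘ (v ᵥ* (g' : Matrix (Fin n) (Fin n) A)) = Pi.single 0 1 := by
      rw [← vecMul_map, hπg, hgv]
    refine ⟨MSERel.mk ⟨v ᵥ* (g' : Matrix (Fin n) (Fin n) A), e.isUnimodular hv, ?_,
      fun i hi => ?_⟩, Quotient.sound e.symm⟩
    · rw [hJ, map_sub, map_one, sub_eq_zero]
      simpa using congrFun hπ 0
    · rw [hJ]
      simpa [hi] using congrFun hπ i

/-- Excision: if `A` is augmented over `ℤ` with augmentation ideal `J`, and `φ : A → R` maps `J`
bijectively onto `I`, then `MSE_n(A, J) → MSE_n(R, I)` is bijective. -/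
theorem IsExcision.map_bijective (hn : 3 ≤ n) (π : A →+* ℤ) {J : Ideal A}
    (hJ : ∀ x, x ∈ J ↔ π x = 0) {R : Type*} [CommRing R] {φ : A →+* R} {I : Ideal R}
    (h : IsExcision φ J I) : Function.Bijective (MSERel.map n φ h.le) := by
  refine ⟨?_, ?_⟩
  · rintro ⟨v, hv⟩ ⟨w, hw⟩ e
    obtain ⟨g, hg, hgv⟩ := Quotient.exact e
    exact Quotient.sound (exists_elementaryRel_of_rowEquiv hn π hJ hv hw
      (h.rowEquiv_of_map hn hv hw hg hgv))
  · rintro ⟨v, hv⟩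
    obtain ⟨u, hu, rfl⟩ := h.exists_umRel hv
    exact ⟨MSERel.mk ⟨u, hu⟩, rfl⟩

end Relative

/-! ### Naturality of absolute orbit spaces and of the Vaserstein–van der Kallen rule. -/

section Naturality

variable {n : ℕ}

theorem MSE.map_bijective {A B : Type*} [CommRing A] [CommRing B] (f : A →+* B)
    (hf : Function.Bijective f) : Function.Bijective (MSE.map n f) := by
  set e : A ≃+* B := RingEquiv.ofBijective f hf
  have he : ∀ v : Fin n → A, (e.symm : B →+* A) ∘ (f ∘ v) = v := fun v => by
    ext i
    exact e.symm_apply_apply (v i)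
  have he' : ∀ v : Fin n → B, f ∘ ((e.symm : B →+* A) ∘ v) = v := fun v => by
    ext i
    exact e.apply_symm_apply (v i)
  refine ⟨?_, ?_⟩
  · rintro ⟨v, hv⟩ ⟨w, hw⟩ h
    obtain ⟨g, hg, hgv⟩ := Quotient.exact h
    replace hgv : (f ∘ v) ᵥ* (g : Matrix (Fin n) (Fin n) B) = f ∘ w := hgv
    refine Quotient.sound ⟨GeneralLinearGroup.map (e.symm : B →+* A) g, elementary_map _ hg, ?_⟩
    change v ᵥ* _ = w
    conv_lhs => rw [← he v]
    rw [vecMul_map, hgv, he]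
  · rintro ⟨v, hv⟩
    refine ⟨MSE.mk ⟨(e.symm : B →+* A) ∘ v, IsUnimodular.map _ hv⟩, ?_⟩
    change MSE.mk ⟨f ∘ ((e.symm : B →+* A) ∘ v), _⟩ = MSE.mk ⟨v, hv⟩
    congr 1
    exact Subtype.ext (he' v)

variable [NeZero n]

theorem vvRow_map {A B : Type*} [CommRing A] [CommRing B] (f : A →+* B) (v : Fin n → A) (b p : A) :
    f ∘ vvRow v b p = vvRow (f ∘ v) (f b) (f p) := by
  ext i
  simp only [vvRow, Function.comp_apply]
  split_ifs <;> simp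

/-- The first coordinate of a mate serves. Existence of one such `p` makes the rule determine the
product of two classes with a common tail. -/
theorem exists_inverse_mod_tail {A : Type*} [CommRing A] {v : Fin n → A} (hv : IsUnimodular v) :
    ∃ p, v 0 * p - 1 ∈ Ideal.span (v '' {i | i ≠ 0}) := by
  obtain ⟨w, hw⟩ := hv
  refine ⟨w 0, ?_⟩
  have : v 0 * w 0 - 1 = -∑ i ∈ Finset.univ.erase 0, v i * w i := by
    rw [← hw, dotProduct, ← Finset.add_sum_erase _ _ (Finset.mem_univ 0)]
    ring
  rw [this]
  refine neg_mem (Ideal.sum_mem _ fun i hi => Ideal.mul_mem_right _ _ (Ideal.subset_span ?_))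
  exact ⟨i, Finset.ne_of_mem_erase hi, rfl⟩

/-- A ring homomorphism is compatible with products given by the Vaserstein–van der Kallen rule. -/
theorem MSE.map_op_of_commonTail {A B : Type*} [CommRing A] [CommRing B] (f : A →+* B)
    {op : MSE n A → MSE n A → MSE n A} {op' : MSE n B → MSE n B → MSE n B} (h : FollowsVv op)
    (h' : FollowsVv op') {x y : MSE n A} (hxy : CommonTail x y) :
    MSE.map n f (op x y) = op' (MSE.map n f x) (MSE.map n f y) := by
  obtain ⟨v, w, rfl, rfl, e⟩ := hxy
  obtain ⟨p, hp⟩ := exists_inverse_mod_tail v.2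
  obtain ⟨hm, h1⟩ := h v w e p hp
  have hp' : (f ∘ v.1) 0 * f p - 1 ∈ Ideal.span ((f ∘ v.1) '' {i | i ≠ 0}) := by
    have := Ideal.mem_map_of_mem f hp
    rw [Ideal.map_span, ← Set.image_comp] at this
    simpa using this
  obtain ⟨hm', h2⟩ := h' ⟨f ∘ v.1, IsUnimodular.map f v.2⟩ ⟨f ∘ w.1, IsUnimodular.map f w.2⟩
    (fun i hi => congrArg f (e i hi)) (f p) hp'
  rw [h1]
  refine Eq.trans ?_ h2.symm
  change MSE.mk ⟨f ∘ vvRow v.1 (w.1 0) p, _⟩ = _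
  congr 1
  exact Subtype.ext (vvRow_map f _ _ _)

end Naturality

/-! ### The excision squares and the comparison of products under `π₂`. -/

section Squares

set_option synthInstance.maxHeartbeats 400000

variable {R : Type*} [CommRing R] (I : Ideal R)

theorem mem_zIdeal {x : ZPlus I} :
    x ∈ zIdeal I ↔ (Unitization.fstHom ℤ I : ZPlus I →+* ℤ) x = 0 := Iff.rfl

theorem isExcision_zHom : IsExcision (zHom I) (zIdeal I) I where
  le := zIdeal_le I
  inj x hx h := by
    have hx : x.fst = 0 := hx
    have h : (x.fst : R) + (x.snd : R) = 0 := h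
    ext
    · exact hx
    · simpa [hx] using h
  surj y hy := ⟨Unitization.inr ⟨y, hy⟩, rfl, by simp [zHom]⟩

theorem isExcision_rHom : IsExcision (rHom I) (rIdeal I) I where
  le := rIdeal_le I
  inj x hx h := by
    have hx : x.fst = 0 := hx
    have h : x.fst + (x.snd : R) = 0 := h
    ext
    · exact hx
    · simpa [hx] using h
  surj y hy := ⟨Unitization.inr ⟨y, hy⟩, rfl, by simp [rHom]⟩

theorem phi_bijective : Function.Bijective (phi I) := by
  refine ⟨fun x y h => ?_, fun y => ?_⟩
  · have h1 : (phi I x).fst = (phi I y).fst := by rw [h]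
    have h2 : (phi I x).snd = (phi I y).snd := by rw [h]
    have hx : (x.snd : RPlus I).fst = 0 := x.snd.2
    have hy : (y.snd : RPlus I).fst = 0 := y.snd.2
    refine Unitization.ext (by simpa [phi] using h1) (Subtype.ext (Unitization.ext ?_ ?_))
    · rw [hx, hy]
    · simpa [phi] using h2
  · refine ⟨Unitization.inl y.fst + Unitization.inr ⟨Unitization.inr y.snd, rfl⟩, ?_⟩
    ext <;> simp [phi]

theorem mapPhi_bijective {n : ℕ} : Function.Bijective (mapPhi I n) :=
  MSE.map_bijective _ (phi_bijective I)

theorem zIdeal_le_comap_phi : zIdeal (rIdeal I) ≤ (zIdeal I).comap (phi I) := by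
  intro x hx
  have hx : x.fst = 0 := hx
  change (phi I x).fst = 0
  simp [phi, hx]

/-- Both sides are `m + i` on `(m, (0, i))`; this square ties `π₂` to `φ`. -/
theorem rHom_zHom (x : ZPlus (rIdeal I)) : rHom I (zHom (rIdeal I) x) = zHom I (phi I x) := by
  have hx : (x.snd : RPlus I).fst = 0 := x.snd.2
  change rHom I ((x.fst : RPlus I) + (x.snd : RPlus I)) = zHom I _
  rw [map_add, map_intCast]
  simp [rHom, zHom, phi, hx]

variable (n : ℕ) [NeZero n]

/-- `MSE_n(ℤ ⊕ (0 ⊕ I), 0 ⊕ I) → MSE_n(ℤ ⊕ I, 0 ⊕ I)`, induced by `φ`. -/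
def mapPhiRel : MSERel n (ZPlus (rIdeal I)) (zIdeal (rIdeal I)) → MSERel n (ZPlus I) (zIdeal I) :=
  MSERel.map n (phi I) (zIdeal_le_comap_phi I)

theorem mapPi₂_mapF (x : MSERel n (ZPlus (rIdeal I)) (zIdeal (rIdeal I))) :
    mapPi₂ I n (mapF (rIdeal I) n x) = mapF I n (mapPhiRel I n x) := by
  obtain ⟨v, hv⟩ := x
  change MSERel.mk ⟨rHom I ∘ (zHom (rIdeal I) ∘ v), _⟩ = MSERel.mk ⟨zHom I ∘ (phi I ∘ v), _⟩
  congr 1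
  exact Subtype.ext (funext fun i => rHom_zHom I (v i))

theorem mapPhi_mapG (x : MSERel n (ZPlus (rIdeal I)) (zIdeal (rIdeal I))) :
    mapPhi I n (mapG (rIdeal I) n x) = mapG I n (mapPhiRel I n x) := by
  obtain ⟨v, hv⟩ := x
  rfl

variable {n}

theorem mapF_bijective (hn : 3 ≤ n) : Function.Bijective (mapF I n) :=
  IsExcision.map_bijective hn (Unitization.fstHom ℤ I : ZPlus I →+* ℤ)
    (fun _ => mem_zIdeal I) (isExcision_zHom I)

theorem mapG_bijective (hn : 3 ≤ n) : Function.Bijective (mapG I n) :=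
  toMSE_bijective hn (Unitization.fstHom ℤ I : ZPlus I →+* ℤ) fun _ => mem_zIdeal I

theorem mapPhiRel_bijective (hn : 3 ≤ n) : Function.Bijective (mapPhiRel I n) := by
  rw [← Function.Bijective.of_comp_iff' (mapG_bijective I hn)]
  have : mapG I n ∘ mapPhiRel I n = mapPhi I n ∘ mapG (rIdeal I) n :=
    funext fun x => (mapPhi_mapG I n x).symm
  rw [this]
  exact (mapPhi_bijective I).comp (mapG_bijective _ hn)

theorem mapPi₂_bijective (hn : 3 ≤ n) : Function.Bijective (mapPi₂ I n) := by
  rw [← Function.Bijective.of_comp_iff _ (mapF_bijective (rIdeal I) hn)]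
  have : mapPi₂ I n ∘ mapF (rIdeal I) n = mapF I n ∘ mapPhiRel I n :=
    funext fun x => mapPi₂_mapF I n x
  rw [this]
  exact (mapF_bijective I hn).comp (mapPhiRel_bijective I hn)

/-- `π₂` is compatible with products given by the Vaserstein–van der Kallen rule. -/
theorem mapPi₂_op (hn : 3 ≤ n) {op : MSERel n R I → MSERel n R I → MSERel n R I}
    {op₁ : MSERel n (RPlus I) (rIdeal I) → MSERel n (RPlus I) (rIdeal I) →
      MSERel n (RPlus I) (rIdeal I)}
    (h : FollowsVvRel I op) (h₁ : FollowsVvRel (rIdeal I) op₁)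
    {x y : MSERel n (RPlus I) (rIdeal I)} (hxy : CommonTailRel (rIdeal I) x y) :
    mapPi₂ I n (op₁ x y) = op (mapPi₂ I n x) (mapPi₂ I n y) := by
  obtain ⟨op', hop, hvv⟩ := h
  obtain ⟨op₁', hop₁, hvv₁⟩ := h₁
  obtain ⟨x', y', rfl, rfl, ht⟩ := hxy
  obtain ⟨z, hz⟩ := (mapF_bijective (rIdeal I) hn).2 (op₁ (mapF _ n x') (mapF _ n y'))
  obtain ⟨t, htF⟩ := (mapF_bijective I hn).2
    (op (mapF I n (mapPhiRel I n x')) (mapF I n (mapPhiRel I n y')))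
  have h1 := hop₁ x' y' z hz
  have h2 := hop _ _ t htF
  -- Naturality along `φ` compares the two products in `MSE_n(ℤ ⊕ I)`; injectivity of `G` and the
  -- square for `F` bring the equality down to `MSE_n(R, I)`.
  have h3 : mapPhi I n _ = _ := MSE.map_op_of_commonTail (phi I) hvv₁ hvv ht
  rw [h1, mapPhi_mapG] at h3
  have h4 : mapG I n (mapPhiRel I n z) = mapG I n t := by
    rw [h3, ← h2, ← mapPhi_mapG, ← mapPhi_mapG]
    rfl
  rw [← hz, mapPi₂_mapF, mapPi₂_mapF, mapPi₂_mapF, (mapG_bijective I hn).1 h4, htF]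

/-- Rows of `Um_n(R, I)` with the same last coordinates have classes whose product is given by the
Vaserstein–van der Kallen rule. -/
theorem commonTailRel_mk {v w : UmRel n R I} (e : ∀ i, i ≠ 0 → w.1 i = v.1 i) :
    CommonTailRel I (MSERel.mk w) (MSERel.mk v) := by
  obtain ⟨v', hv', ev⟩ := (isExcision_zHom I).exists_umRel v.2
  obtain ⟨w', hw', ew⟩ := (isExcision_zHom I).exists_umRel w.2
  refine ⟨MSERel.mk ⟨w', hw'⟩, MSERel.mk ⟨v', hv'⟩, congrArg MSERel.mk (Subtype.ext ew),
    congrArg MSERel.mk (Subtype.ext ev), ⟨v', hv'.1⟩, ⟨w', hw'.1⟩, rfl, rfl, fun i hi => ?_⟩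
  refine (isExcision_zHom I).eq_of_map_eq (Ideal.sub_mem _ (hw'.2.2 i hi) (hv'.2.2 i hi)) ?_
  have h1 : zHom I (w' i) = w.1 i := congrFun ew i
  have h2 : zHom I (v' i) = v.1 i := congrFun ev i
  rw [h1, h2, e i hi]

/-- Rows with a common tail correspond under `π₂` in both directions, and `π₂` respects their
products by `mapPi₂_op`. Niceness thus transfers down directly, and up by injectivity of `π₂` on
classes. -/
theorem isNiceRel_iff (hn : 3 ≤ n) {op : MSERel n R I → MSERel n R I → MSERel n R I}
    {op₁ : MSERel n (RPlus I) (rIdeal I) → MSERel n (RPlus I) (rIdeal I) →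
      MSERel n (RPlus I) (rIdeal I)}
    (h : FollowsVvRel I op) (h₁ : FollowsVvRel (rIdeal I) op₁) :
    IsNiceRel (rIdeal I) op₁ ↔ IsNiceRel I op := by
  have hexc := isExcision_rHom I
  have hupd : ∀ v w : Fin n → RPlus I, rHom I ∘ Function.update v 0 (v 0 * w 0) =
      Function.update (rHom I ∘ v) 0 ((rHom I ∘ v) 0 * (rHom I ∘ w) 0) := fun v w => by
    rw [Function.comp_update, map_mul]
    rfl
  constructor
  · rintro hnice ⟨v, hv⟩ ⟨w, hw⟩ e
    obtain ⟨v', hv', rfl⟩ := hexc.exists_umRel hv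
    obtain ⟨w', hw', rfl⟩ := hexc.exists_umRel hw
    have e' : ∀ i, i ≠ 0 → w' i = v' i := fun i hi =>
      hexc.eq_of_map_eq (Ideal.sub_mem _ (hw'.2.2 i hi) (hv'.2.2 i hi)) (e i hi)
    obtain ⟨hm, hprod⟩ := hnice ⟨v', hv'⟩ ⟨w', hw'⟩ e'
    have key := mapPi₂_op I hn h h₁
      (commonTailRel_mk (rIdeal I) (v := ⟨v', hv'⟩) (w := ⟨w', hw'⟩) e')
    have hm' : rHom I ∘ Function.update v' 0 (v' 0 * w' 0) ∈ UmRel n R I :=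
      ⟨IsUnimodular.map _ hm.1, by simpa using hexc.le hm.2.1, fun i hi => hexc.le (hm.2.2 i hi)⟩
    refine ⟨hupd v' w' ▸ hm', ?_⟩
    refine key.symm.trans ?_
    rw [hprod]
    exact congrArg MSERel.mk (Subtype.ext (hupd v' w'))
  · rintro hnice ⟨v, hv⟩ ⟨w, hw⟩ e
    have hv' : rHom I ∘ v ∈ UmRel n R I :=
      ⟨IsUnimodular.map _ hv.1, by simpa using hexc.le hv.2.1, fun i hi => hexc.le (hv.2.2 i hi)⟩
    have hw' : rHom I ∘ w ∈ UmRel n R I :=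
      ⟨IsUnimodular.map _ hw.1, by simpa using hexc.le hw.2.1, fun i hi => hexc.le (hw.2.2 i hi)⟩
    obtain ⟨hm, hprod⟩ := hnice ⟨_, hv'⟩ ⟨_, hw'⟩ fun i hi => congrArg (rHom I) (e i hi)
    have key := mapPi₂_op I hn h h₁
      (commonTailRel_mk (rIdeal I) (v := ⟨v, hv⟩) (w := ⟨w, hw⟩) e)
    have hm' : Function.update v 0 (v 0 * w 0) ∈ UmRel n (RPlus I) (rIdeal I) := by
      refine hexc.mem_umRel ?_ (fun i hi => ?_) ?_
      · have : v 0 * w 0 - 1 = v 0 * (w 0 - 1) + (v 0 - 1) := by ring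
        rw [Function.update_self, this]
        exact Ideal.add_mem _ (Ideal.mul_mem_left _ _ hw.2.1) hv.2.1
      · rw [Function.update_of_ne hi]
        exact hv.2.2 i hi
      · rw [hupd]
        exact hm.1
    refine ⟨hm', (mapPi₂_bijective I hn).1 (key.trans ?_)⟩
    refine Eq.trans hprod ?_
    exact congrArg MSERel.mk (Subtype.ext (hupd v w).symm)

end Squares

end Excision

end

open Excision in
theorem mainTheorem6 {R : Type*} [CommRing R] (I : Ideal R) (n : ℕ) [NeZero n] (hn : 3 ≤ n) :
    (Function.Bijective (mapF (rIdeal I) n) ∧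
      Function.Bijective (mapG (rIdeal I) n) ∧
      Function.Bijective (mapPhi I n) ∧
      Function.Bijective (mapG I n) ∧
      Function.Bijective (mapF I n) ∧
      Function.Bijective (mapPi₂ I n)) ∧
    (∀ [Group (MSERel n R I)] [Group (MSERel n (RPlus I) (rIdeal I))],
      FollowsVvRel I (fun x y : MSERel n R I => x * y) →
      FollowsVvRel (rIdeal I) (fun x y : MSERel n (RPlus I) (rIdeal I) => x * y) →
        (∀ x y : MSERel n (RPlus I) (rIdeal I), CommonTailRel (rIdeal I) x y →
          mapPi₂ I n (x * y) = mapPi₂ I n x * mapPi₂ I n y) ∧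
        ((∀ x y : MSERel n (RPlus I) (rIdeal I), CommonTailRel (rIdeal I) x y) →
          ∃ ψ : MSERel n (RPlus I) (rIdeal I) →* MSERel n R I, ⇑ψ = mapPi₂ I n) ∧
        (IsNiceRel (rIdeal I) (fun x y : MSERel n (RPlus I) (rIdeal I) => x * y) ↔
          IsNiceRel I (fun x y : MSERel n R I => x * y))) := by
  refine ⟨⟨mapF_bijective _ hn, mapG_bijective _ hn, mapPhi_bijective I, mapG_bijective I hn,
    mapF_bijective I hn, mapPi₂_bijective I hn⟩, ?_⟩
  intro _ _ h h₁
  exact ⟨fun x y hxy => mapPi₂_op I hn h h₁ hxy,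
    fun hall => ⟨MonoidHom.mk' (mapPi₂ I n) fun x y => mapPi₂_op I hn h h₁ (hall x y), rfl⟩,
    isNiceRel_iff I hn h h₁⟩
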